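/- **Setting.** Let $m\ge 1$, $M=2^m$, $\sigma>0$, $\Delta=\sqrt{3/(2(M^2-1))}$ and, for $0\le j\le M/2-1$, $$w_j=\frac{2\,(2^{m-\lceil\log_2(j+1)\rceil}-1)}{mM},\qquad \mu_j=\frac{2\Delta^2(j+1)^2}{\sigma^2},\qquad \sigma_j^2=\frac{4\Delta^2(j+1)^2}{\sigma^2}.$$ For BICM with $M^2$-QAM, binary reflected Gray mapping and noise variance $\sigma^2$ per real dimension, the max-log LLR $l$ of a transmitted bit $b$ is modelled by the density $p(l|b)=\sum_{j=0}^{M/2-1}w_j\,\mathsf G(l;(-1)^b\mu_j,\sigma_j^2)$, where $\mathsf G(\cdot\,;\mu,\sigma^2)$ is the Gaussian density. Channel adapters symmetrize it: $p(\bar l=l|b)=\tfrac12\,(p(l|b)+p(-l|1-b))$. Let $\mathcal C$ be a binary linear code of length $n\ge1$ with minimum distance $d_{\min}$ and $t=\lfloor (d_{\min}-1)/2\rfloor$, such that no coordinate is identically zero on $\mathcal C$ (for instance a BCH code). Consider the GLDPC ensemble with $K$ row-type and $K$ column-type constraint nodes (CNs) of degree $n$, all with component code $\mathcal C$, and $nK$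 variable nodes (VNs), each attached to one row-type and one column-type CN through a uniformly random edge interleaver. The all-zero codeword is sent, and the channel LLRs of the VNs are independent with density $p(\bar l|0)$. Let $\mathsf B(l)=1$ if $l<0$ and $\mathsf B(l)=0$ otherwise. In extrinsic iBDD-CR, the messages are bits. At iteration $0$ each VN carries the hard decision $\mathsf B(\bar l)$; each iteration $\ell\ge1$ consists of a row step followed by a column step. For each of its bits, an active CN replaces the incoming message on that bit by the channel hard decision $\mathsf B(\bar l)$, applies bounded distance decoding of radius $t$ to the resulting word, and gets an output $\bar\mu\in\{1,-1,0\}$ for the bit (decoded to $0$, decoded to $1$, failure). It then sends $\mathsf B(\tilde l)$, where $$\tilde l=\ln\frac{p(\bar\mu,\bar l\,|\,c=0)}{p(\bar\mu,\bar l\,|\,c=1)},\qquad p(\bar\mu,\bar l\,|\,c=b)=p(\bar\mu\,|\,\mathsf B(\bar l),c=b)\,p(\bar l|b).$$ Here $p(\bar\mu|r,c=b)$ is computed for a uniformly random bit of a uniformly random component codeword, given that the bit is $b$ and that its channel hard decision is $r$, the other $n-1$ bits being received in error independently with probability $x$; $x$ is the message error probability at the input of the CN. Let $x^{\mathsf r,(\ell)}$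 ($\ell\ge1$) and $x^{\mathsf c,(\ell)}$ ($\ell\ge0$) be the ensemble-average error probabilities of the messages sent at iteration $\ell$ by row-type and by column-type CNs, in the limit $K\to\infty$ ($x^{\mathsf c,(0)}$ being that of the initial hard decisions). The combining rule uses $x=x^{\mathsf c,(\ell-1)}$ in the row step and $x=x^{\mathsf r,(\ell)}$ in the column step of iteration $\ell$. For a uniformly random bit of the all-zero component codeword, with $i$ errors uniformly placed in the other $n-1$ positions, let $P^{\mathsf e}(i),P^{\mathsf c}(i)$ be the probabilities that bounded distance decoding decodes the bit incorrectly and correctly when it is received in error, let $Q^{\mathsf e}(i),Q^{\mathsf c}(i)$ be the same when it is received correctly, and let $P^\epsilon=1-P^{\mathsf e}-P^{\mathsf c}$, $Q^\epsilon=1-Q^{\mathsf e}-Q^{\mathsf c}$. For each of these six functions $A$ let $f^{A}(x)=\sum_{i=0}^{n-1}\binom{n-1}{i}x^i(1-x)^{n-1-i}A(i)$. Let $\mathsf Q(x)=\frac1{\sqrt{2\pi}}\int_x^\infty e^{-\xi^2/2}d\xi$, and let $\bar{\mathbb U}(x)=1$ if $x<0$ and $0$ otherwise. **Proposition 2.**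 These limits exist (the probabilities $x^{\mathsf c,(0)},x^{\mathsf r,(1)},x^{\mathsf c,(1)},\dots$ are well defined), and $$x^{\mathsf c,(0)}=\sum_{j=0}^{M/2-1}w_j\,\mathsf Q\!\left(\frac{\mu_j}{\sigma_j}\right),\qquad x^{\mathsf r,(\ell)}=\mathsf g(x^{\mathsf c,(\ell-1)}),\qquad x^{\mathsf c,(\ell)}=\mathsf g(x^{\mathsf r,(\ell)})\qquad(\ell\ge1),$$ where, with all functions $f$ taken at $x$, $$\mathsf g(x)=\sum_{(A,B)}f^{A}\sum_{j=0}^{M/2-1}w_j\,\mathsf Q\!\left(\frac{\max(\ln\frac{f^{A}}{f^{B}},0)+\mu_j}{\sigma_j}\right)+\sum_{(A,B)}f^{B}\,\bar{\mathbb U}\!\left(\ln\tfrac{f^{B}}{f^{A}}\right)\sum_{j=0}^{M/2-1}w_j\left(\mathsf Q\!\left(\frac{\ln\frac{f^{B}}{f^{A}}+\mu_j}{\sigma_j}\right)-\mathsf Q\!\left(\frac{\mu_j}{\sigma_j}\right)\right)$$ and $(A,B)$ runs over $(P^{\mathsf e},Q^{\mathsf c})$, $(P^{\mathsf c},Q^{\mathsf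 e})$, $(P^{\epsilon},Q^{\epsilon})$; terms of a pair with $f^A=f^B=0$ are zero. -/

import Mathlib

open MeasureTheory ProbabilityTheory Filter Topology

namespace IBDDCR

noncomputable section

/-! ### The BICM channel -/

/-- Tail probability of the standard Gaussian distribution. -/
def Q (x : ℝ) : ℝ :=
  (√(2 * Real.pi))⁻¹ * ∫ ξ in Set.Ioi x, Real.exp (-ξ ^ 2 / 2)

/-- Scaling factor of the `M`-ASK constellation, `M = 2 ^ m`, normalizing `M²`-QAM to unit energy. -/
def Delta (m : ℕ) : ℝ := √(3 / (2 * (((2 : ℝ) ^ m) ^ 2 - 1)))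

/-- Weight `w_j` of the `j`-th mixture component; `Nat.clog 2 (j + 1)` is `⌈log₂ (j + 1)⌉`, which
is at most `m - 1` for the indices `j < 2 ^ m / 2` that occur. -/
def weight (m j : ℕ) : ℝ :=
  2 * ((2 : ℝ) ^ (m - Nat.clog 2 (j + 1)) - 1) / (m * 2 ^ m)

/-- Mean `μ_j` of the `j`-th mixture component. -/
def mean (m : ℕ) (σ : ℝ) (j : ℕ) : ℝ := 2 * Delta m ^ 2 * (j + 1) ^ 2 / σ ^ 2

/-- Variance `σ_j²` of the `j`-th mixture component. -/
def var (m : ℕ) (σ : ℝ) (j : ℕ) : ℝ := 4 * Delta m ^ 2 * (j + 1) ^ 2 / σ ^ 2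

/-- Standard deviation `σ_j` of the `j`-th mixture component. -/
def sd (m : ℕ) (σ : ℝ) (j : ℕ) : ℝ := √(var m σ j)

/-- The Gaussian-mixture model `p(l | b)` of the max-log LLR `l` of a transmitted bit `b`. -/
def llrPdf (m : ℕ) (σ : ℝ) (b : ZMod 2) (l : ℝ) : ℝ :=
  ∑ j ∈ Finset.range (2 ^ m / 2),
    weight m j * gaussianPDFReal ((-1) ^ b.val * mean m σ j) (var m σ j).toNNReal l

/-- The LLR density of the channel symmetrized by channel adapters. -/
def symLlrPdf (m : ℕ) (σ : ℝ) (b : ZMod 2) (l : ℝ) : ℝ :=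
  (llrPdf m σ b l + llrPdf m σ (1 - b) (-l)) / 2

/-- The law of the symmetrized LLR of a transmitted bit `b`. -/
def symLlrLaw (m : ℕ) (σ : ℝ) (b : ZMod 2) : Measure ℝ :=
  volume.withDensity fun l => ENNReal.ofReal (symLlrPdf m σ b l)

/-- Hard decision on a soft value: negative values give bit `1`, the others bit `0`. -/
def hardBit (l : ℝ) : ZMod 2 := if l < 0 then 1 else 0

/-! ### Component code and bounded distance decoding -/

variable {n : ℕ}

/-- Minimum Hamming distance of a binary linear code. -/
def minDist (C : Submodule (ZMod 2) (Fin n → ZMod 2)) : ℕ :=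
  sInf {d | ∃ c ∈ C, ∃ c' ∈ C, c ≠ c' ∧ hammingDist c c' = d}

open scoped Classical in
/-- Output of bounded distance decoding with radius `t` at position `j`, for the input word `w`:
`1` or `-1` if the codeword within distance `t` of `w` has a `0` or a `1` at position `j`, and `0`
if there is no such codeword. (For `2 t < minDist C` there is at most one such codeword.) -/
def bddOut (C : Submodule (ZMod 2) (Fin n → ZMod 2)) (t : ℕ) (w : Fin n → ZMod 2) (j : Fin n) :
    SignType :=
  if ∃ c ∈ C, hammingDist c w ≤ t ∧ c j = 0 then 1
  else if ∃ c ∈ C, hammingDist c w ≤ t ∧ c j = 1 then -1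
  else 0

/-! ### The combining rule of iBDD-CR -/

open scoped Classical in
/-- Conditional probability `p(μ̄ = s | r, c = b)` that extrinsic bounded distance decoding outputs
`s` on a bit, given that the bit is `b` and that its channel hard decision is `r`. The transmitted
codeword `c` is uniform on the code, the position `j` of the bit is uniform, and the bits at the
other positions are received in error independently with probability `x` (`e` is the error
pattern). -/
def outProb (C : Submodule (ZMod 2) (Fin n → ZMod 2)) (t : ℕ) (x : ℝ) (b r : ZMod 2)
    (s : SignType) : ℝ :=
  (∑ j : Fin n, ∑ c : Fin n → ZMod 2 with c ∈ C ∧ c j = b,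
      ∑ e : Fin n → ZMod 2 with c j + e j = r ∧ bddOut C t (c + e) j = s,
        ∏ i ∈ Finset.univ.erase j, (if e i = 1 then x else 1 - x)) /
    ∑ j : Fin n, ((Finset.univ.filter fun c : Fin n → ZMod 2 => c ∈ C ∧ c j = b).card : ℝ)

/-- The soft value `ln (p(μ̄, l | c = 0) / p(μ̄, l | c = 1))` of a bit, given its extrinsic bounded
distance decoding output `s` and its channel LLR `l`; `x` is the error probability of the
messages entering the constraint node. As the decoder sees `l` only through its hard decision,
`p(μ̄, l | c = b) = p(μ̄ | r, c = b) * p(l | c = b)` with `r` the hard decision on `l`. -/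
def softValue (C : Submodule (ZMod 2) (Fin n → ZMod 2)) (t m : ℕ) (σ x : ℝ) (s : SignType)
    (l : ℝ) : ℝ :=
  Real.log ((outProb C t x 0 (hardBit l) s * symLlrPdf m σ 0 l) /
    (outProb C t x 1 (hardBit l) s * symLlrPdf m σ 1 l))

/-- Outgoing message of a constraint node at position `j`: the node replaces the incoming bit at
`j` by the channel hard decision, decodes, combines the result with the channel LLR `l` of that
bit, and takes a hard decision. -/
def cnMessage (C : Submodule (ZMod 2) (Fin n → ZMod 2)) (t m : ℕ) (σ x : ℝ)
    (ψ : Fin n → ZMod 2) (j : Fin n) (l : ℝ) : ZMod 2 :=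
  hardBit (softValue C t m σ x (bddOut C t (Function.update ψ j (hardBit l)) j) l)

/-! ### The GLDPC ensemble and its message passing decoder -/

/-- Sockets of `K` constraint nodes of degree `n`. A graph of the ensemble has `K` row-type and `K`
column-type constraint nodes and `K * n` variable nodes of degree two. Variable nodes are named by
the row socket to which they are attached; the edge interleaver is a permutation `π`, and variable
node `v` is attached to the column socket `π v`. -/
abbrev Socket (K n : ℕ) := Fin K × Fin n

/-- Messages sent by all row-type constraint nodes, for incoming messages `ψ`. -/
def rowStep (C : Submodule (ZMod 2) (Fin n → ZMod 2)) (t m : ℕ) (σ x : ℝ) {K : ℕ}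
    (l : Socket K n → ℝ) (ψ : Socket K n → ZMod 2) : Socket K n → ZMod 2 :=
  fun v => cnMessage C t m σ x (fun i => ψ (v.1, i)) v.2 (l v)

/-- Messages sent by all column-type constraint nodes, for incoming messages `ψ`. -/
def colStep (C : Submodule (ZMod 2) (Fin n → ZMod 2)) (t m : ℕ) (σ x : ℝ) {K : ℕ}
    (π : Equiv.Perm (Socket K n)) (l : Socket K n → ℝ) (ψ : Socket K n → ZMod 2) :
    Socket K n → ZMod 2 :=
  fun v => cnMessage C t m σ x (fun i => ψ (π.symm ((π v).1, i))) (π v).2 (l v)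

/-- The messages of extrinsic iBDD-CR sent by the column-type constraint nodes at iteration `ℓ`,
for channel LLRs `l`; iteration `0` stands for the channel hard decisions. The combining rule is
run with the input error probabilities `xc (ℓ - 1)` (row step of iteration `ℓ`) and `xr ℓ` (column
step of iteration `ℓ`). -/
def colMsg (C : Submodule (ZMod 2) (Fin n → ZMod 2)) (t m : ℕ) (σ : ℝ) (xr xc : ℕ → ℝ) {K : ℕ}
    (π : Equiv.Perm (Socket K n)) (l : Socket K n → ℝ) : ℕ → Socket K n → ZMod 2
  | 0 => fun v => hardBit (l v)
  | ℓ + 1 =>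
    colStep C t m σ (xr (ℓ + 1)) π l (rowStep C t m σ (xc ℓ) l (colMsg C t m σ xr xc π l ℓ))

/-- The messages sent by the row-type constraint nodes at iteration `ℓ + 1`. -/
def rowMsgSucc (C : Submodule (ZMod 2) (Fin n → ZMod 2)) (t m : ℕ) (σ : ℝ) (xr xc : ℕ → ℝ) {K : ℕ}
    (π : Equiv.Perm (Socket K n)) (l : Socket K n → ℝ) (ℓ : ℕ) : Socket K n → ZMod 2 :=
  rowStep C t m σ (xc ℓ) l (colMsg C t m σ xr xc π l ℓ)

/-- Ensemble average of the message error probability when the all-zero codeword is sent: the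
interleaver and the variable node are uniform, and the LLRs are independent with the law of the
symmetrized LLR of a zero bit. `msg π l v` is the message on the edge of `v`. -/
def avgErr (m : ℕ) (σ : ℝ) (n K : ℕ)
    (msg : Equiv.Perm (Socket K n) → (Socket K n → ℝ) → Socket K n → ZMod 2) : ℝ :=
  (∑ π : Equiv.Perm (Socket K n), ∑ v : Socket K n,
      (Measure.pi fun _ : Socket K n => symLlrLaw m σ 0).real {l | msg π l v = 1}) /
    (Fintype.card (Equiv.Perm (Socket K n)) * Fintype.card (Socket K n))

/-- `xr` and `xc` are the message error probabilities of iBDD-CR at the row-type and the column-type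
constraint nodes of the GLDPC ensemble, in the limit of infinite block length, when the
combining rule of the decoder uses these same probabilities. -/
def IsMessageErrorProb (C : Submodule (ZMod 2) (Fin n → ZMod 2)) (t m : ℕ) (σ : ℝ)
    (xr xc : ℕ → ℝ) : Prop :=
  (∀ ℓ, Tendsto (fun K => avgErr m σ n K fun π l => colMsg C t m σ xr xc π l ℓ) atTop
    (𝓝 (xc ℓ))) ∧
  ∀ ℓ, Tendsto (fun K => avgErr m σ n K fun π l => rowMsgSucc C t m σ xr xc π l ℓ) atTop
    (𝓝 (xr (ℓ + 1)))

/-! ### The density evolution map -/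

open scoped Classical in
/-- Probability that a randomly selected bit of the all-zero codeword is decoded to `s` by bounded
distance decoding, when it is received as `r` and there are `i` errors, uniformly placed, in the
other `n - 1` positions. -/
def decProb (C : Submodule (ZMod 2) (Fin n → ZMod 2)) (t : ℕ) (r : ZMod 2) (s : SignType)
    (i : ℕ) : ℝ :=
  (∑ j : Fin n,
      (((Finset.univ.erase j).powersetCard i).filter fun S =>
        bddOut C t (fun k => if k = j then r else if k ∈ S then 1 else 0) j = s).card /
      ((n - 1).choose i : ℝ)) / n

/-- Average of `P i` over the binomially distributed number `i` of errors in `n - 1` positions. -/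
def binAvg (n : ℕ) (P : ℕ → ℝ) (x : ℝ) : ℝ :=
  ∑ i ∈ Finset.range n, ((n - 1).choose i : ℝ) * x ^ i * (1 - x) ^ (n - i - 1) * P i

/-- Initially in error, decoded incorrectly. -/
def fPe (C : Submodule (ZMod 2) (Fin n → ZMod 2)) (t : ℕ) : ℝ → ℝ := binAvg n (decProb C t 1 (-1))

/-- Initially in error, decoded correctly. -/
def fPc (C : Submodule (ZMod 2) (Fin n → ZMod 2)) (t : ℕ) : ℝ → ℝ := binAvg n (decProb C t 1 1)

/-- Initially in error, erased. -/
def fPeps (C : Submodule (ZMod 2) (Fin n → ZMod 2)) (t : ℕ) : ℝ → ℝ :=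
  binAvg n fun i => 1 - decProb C t 1 (-1) i - decProb C t 1 1 i

/-- Initially correct, decoded incorrectly. -/
def fQe (C : Submodule (ZMod 2) (Fin n → ZMod 2)) (t : ℕ) : ℝ → ℝ := binAvg n (decProb C t 0 (-1))

/-- Initially correct, decoded correctly. -/
def fQc (C : Submodule (ZMod 2) (Fin n → ZMod 2)) (t : ℕ) : ℝ → ℝ := binAvg n (decProb C t 0 1)

/-- Initially correct, erased. -/
def fQeps (C : Submodule (ZMod 2) (Fin n → ZMod 2)) (t : ℕ) : ℝ → ℝ :=
  binAvg n fun i => 1 - decProb C t 0 (-1) i - decProb C t 0 1 i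

/-- Indicator of the negative half line. -/
def Ubar (x : ℝ) : ℝ := if x < 0 then 1 else 0

/-- The weighted sum `∑ j, w_j Q((a + μ_j) / σ_j)`. -/
def mixQ (m : ℕ) (σ a : ℝ) : ℝ :=
  ∑ j ∈ Finset.range (2 ^ m / 2), weight m j * Q ((a + mean m σ j) / sd m σ j)

/-- The weighted sum `∑ j, w_j (Q((a + μ_j) / σ_j) - Q(μ_j / σ_j))`. -/
def mixQDiff (m : ℕ) (σ a : ℝ) : ℝ :=
  ∑ j ∈ Finset.range (2 ^ m / 2),
    weight m j * (Q ((a + mean m σ j) / sd m σ j) - Q (mean m σ j / sd m σ j))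

/-- The map of one half-iteration of density evolution. The maxima come from
`P(l < -a, l < 0) = P(l < -max a 0)` for `a` the log ratio. -/
def g (C : Submodule (ZMod 2) (Fin n → ZMod 2)) (t m : ℕ) (σ x : ℝ) : ℝ :=
  fPe C t x * mixQ m σ (max (Real.log (fPe C t x / fQc C t x)) 0) +
  fPc C t x * mixQ m σ (max (Real.log (fPc C t x / fQe C t x)) 0) +
  fPeps C t x * mixQ m σ (max (Real.log (fPeps C t x / fQeps C t x)) 0) +
  fQe C t x * mixQDiff m σ (Real.log (fQe C t x / fPc C t x)) *
    Ubar (Real.log (fQe C t x / fPc C t x)) +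
  fQc C t x * mixQDiff m σ (Real.log (fQc C t x / fPe C t x)) *
    Ubar (Real.log (fQc C t x / fPe C t x)) +
  fQeps C t x * mixQDiff m σ (Real.log (fQeps C t x / fPeps C t x)) *
    Ubar (Real.log (fQeps C t x / fPeps C t x))

end

end IBDDCR

/-!
Fix a graph with `K` constraint nodes on each side, and explore it from a socket. Every tree of
sockets in distinct constraint nodes is the outcome of at least its uniform share of the pairs of
a graph and a starting socket, and all but a vanishing fraction of the trees are of this kind.
Hence the probability that a message takes a given value is at least its probability on a random
tree, up to `o(1)`. Both laws have total mass one, so the former tends to the latter, for which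
the incoming messages of a constraint node are independent.

Bounded distance decoding commutes with adding codewords, and `p(l | 0) = e^l p(l | 1)` for the
channel. The combining rule therefore compares `l` with the logarithm of a ratio of decoding rates,
and the mass of the Gaussian mixture beyond this threshold is the recursion `g`. Its iterates stay
in `(0, 1)`, where two rates that the rule compares vanish together. By induction on the
half-iterations, they are the only parameters that the decoder reproduces as its own error
probabilities.
-/

namespace IBDDCR

noncomputable section

open scoped Classical BigOperators

/-! ### Averages over finite types -/

section Averages

variable {α β ι : Type*} [Fintype α] [Fintype β] [Fintype ι]

theorem expect_snd [Nonempty α] (F : β → ℝ) : 𝔼 p : α × β, F p.2 = 𝔼 b, F b :=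
  (Finset.expect_product' Finset.univ Finset.univ fun (_ : α) b => F b).trans
    (Fintype.expect_const _)

theorem expect_fst_comp [DecidableEq ι] [Nonempty β] (F : (ι → α) → ℝ) :
    𝔼 x : ι → α × β, F (fun i => (x i).1) = 𝔼 y, F y :=
  (Fintype.expect_equiv ((Equiv.arrowProdEquivProdArrow ι _ _).trans (Equiv.prodComm _ _)) _
    (fun p : (ι → β) × (ι → α) => F p.2) fun _ => rfl).trans (expect_snd F)

theorem expect_pi_prod [DecidableEq ι] (f : ι → α → ℝ) :
    𝔼 x : ι → α, ∏ i, f i (x i) = ∏ i, 𝔼 a, f i a := by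
  simp only [Fintype.expect_eq_sum_div_card, Finset.prod_div_distrib, Finset.prod_univ_sum,
    Fintype.piFinset_univ, Fintype.card_fun, Finset.prod_const, Finset.card_univ, Nat.cast_pow]

theorem expect_le_expect_comp [DecidableEq β] [Nonempty α] (φ : α → β) {F : β → ℝ}
    (hF : ∀ b, 0 ≤ F b)
    (hφ : ∀ b, F b ≠ 0 → Fintype.card α ≤ Fintype.card {a // φ a = b} * Fintype.card β) :
    𝔼 b, F b ≤ 𝔼 a, F (φ a) := by
  have hα : (0 : ℝ) < Fintype.card α := by exact_mod_cast Fintype.card_pos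
  have hβ : Nonempty β := ‹Nonempty α›.map φ
  have hβ : (0 : ℝ) < Fintype.card β := by exact_mod_cast Fintype.card_pos
  have hfib : ∑ a, F (φ a) = ∑ b, Fintype.card {a // φ a = b} * F b := by
    rw [← Fintype.sum_fiberwise φ]
    refine Finset.sum_congr rfl fun b _ => ?_
    rw [Fintype.sum_congr _ (fun _ => F b) fun a => by rw [a.2]]
    simp
  rw [Fintype.expect_eq_sum_div_card, Fintype.expect_eq_sum_div_card, hfib, div_le_div_iff₀ hβ hα,
    Finset.sum_mul, Finset.sum_mul]
  refine Finset.sum_le_sum fun b _ => ?_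
  obtain hb | hb := eq_or_ne (F b) 0
  · simp [hb]
  · calc F b * Fintype.card α ≤ F b * (Fintype.card {a // φ a = b} * Fintype.card β) :=
          mul_le_mul_of_nonneg_left (by exact_mod_cast hφ b hb) (hF b)
      _ = _ := by ring

theorem tendsto_expect_not_injective (ι : Type*) [Fintype ι] :
    Tendsto (fun K : ℕ => 𝔼 x : ι → Fin K, if Function.Injective x then (0 : ℝ) else 1) atTop
      (𝓝 0) := by
  have hprob : ∀ᶠ K : ℕ in atTop, (𝔼 x : ι → Fin K, if Function.Injective x then (0 : ℝ) else 1) =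
      1 - K.descFactorial (Fintype.card ι) / (K : ℝ) ^ Fintype.card ι := by
    filter_upwards [eventually_ge_atTop 1] with K hK
    have : NeZero K := ⟨by omega⟩
    have hcard : Fintype.card {x : ι → Fin K // Function.Injective x} =
        K.descFactorial (Fintype.card ι) := by
      rw [Fintype.card_congr (Equiv.subtypeInjectiveEquivEmbedding _ _),
        Fintype.card_embedding_eq, Fintype.card_fin]
    calc (𝔼 x : ι → Fin K, if Function.Injective x then (0 : ℝ) else 1)
        = 𝔼 x : ι → Fin K, (1 - if Function.Injective x then (1 : ℝ) else 0) :=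
          Finset.expect_congr rfl fun x _ => by split_ifs <;> simp
      _ = 1 - K.descFactorial (Fintype.card ι) / (K : ℝ) ^ Fintype.card ι := by
          rw [Finset.expect_sub_distrib, Fintype.expect_one, Fintype.expect_eq_sum_div_card,
            Finset.sum_boole, ← Fintype.card_subtype, hcard, Fintype.card_fun, Fintype.card_fin,
            Nat.cast_pow]
  have hequiv := (Asymptotics.isEquivalent_iff_tendsto_one ?_).1
    (isEquivalent_descFactorial (Fintype.card ι))
  · simpa using (tendsto_congr' hprob).2 (hequiv.const_sub 1)
  · filter_upwards [eventually_ne_atTop 0] with K hK using by positivity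

theorem card_perm_le_card_prescribed_mul_pow [DecidableEq α] {a b : ι → α}
    (ha : Function.Injective a) (hb : Function.Injective b) :
    Fintype.card (Equiv.Perm α) ≤
      Fintype.card {f : Equiv.Perm α // ∀ i, f (a i) = b i} *
        Fintype.card α ^ Fintype.card ι := by
  have hle (b' : ι → α) : Fintype.card {f : Equiv.Perm α // f ∘ a = b'} ≤
      Fintype.card {f : Equiv.Perm α // ∀ i, f (a i) = b i} := by
    by_cases hb' : Function.Injective b'
    · obtain ⟨τ, hτ⟩ := Equiv.Perm.exists_extending_pair b' b hb' hb
      refine Fintype.card_le_of_injective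
        (fun f => ⟨τ * f.1, fun i => ?_⟩) fun f g h => ?_
      · simpa [← f.2] using hτ i
      · simpa [Subtype.ext_iff] using h
    · have : IsEmpty {f : Equiv.Perm α // f ∘ a = b'} :=
        ⟨fun f => hb' (f.2 ▸ f.1.injective.comp ha)⟩
      simp
  calc Fintype.card (Equiv.Perm α)
      = ∑ b' : ι → α, Fintype.card {f : Equiv.Perm α // f ∘ a = b'} := by
        rw [← Fintype.card_sigma, Fintype.card_congr (Equiv.sigmaFiberEquiv _)]
    _ ≤ Fintype.card (ι → α) * Fintype.card {f : Equiv.Perm α // ∀ i, f (a i) = b i} :=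
        Finset.sum_le_card_nsmul _ _ _ fun b' _ => hle b'
    _ = _ := by rw [Fintype.card_fun, mul_comm]

end Averages

section Measures

variable {Λ B ι : Type*} [MeasurableSpace Λ] [Fintype B] [Fintype ι]

theorem sum_measureReal_and {μ : Measure Λ} [IsFiniteMeasure μ] (p : Λ → Prop) {φ : Λ → B}
    (hφ : ∀ b, MeasurableSet {x | φ x = b}) :
    ∑ b, μ.real {x | p x ∧ φ x = b} = μ.real {x | p x} := by
  have hsum := sum_measureReal_preimage_singleton (μ := μ.restrict {x | p x}) Finset.univ
    (f := φ) fun b _ => hφ b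
  rw [Finset.coe_univ, Set.preimage_univ, measureReal_restrict_apply_univ] at hsum
  rw [← hsum]
  refine Finset.sum_congr rfl fun b _ => ?_
  exact (congrArg μ.real (Set.inter_comm _ _)).trans (measureReal_restrict_apply (hφ b)).symm

theorem sum_measureReal_eq_one {μ : Measure Λ} [IsProbabilityMeasure μ] {φ : Λ → B}
    (hφ : ∀ b, MeasurableSet {x | φ x = b}) : ∑ b, μ.real {x | φ x = b} = 1 := by
  simpa using sum_measureReal_and (μ := μ) (fun _ => True) hφ

theorem measurePreserving_comp_injective {α : Type*} [Fintype α] (μ : Measure Λ)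
    [IsProbabilityMeasure μ] {a : ι → α} (ha : Function.Injective a) :
    MeasurePreserving (fun (l : α → Λ) i => l (a i)) (Measure.pi fun _ => μ)
      (Measure.pi fun _ => μ) := by
  refine ⟨by fun_prop, ?_⟩
  have hind : iIndepFun (fun (x : α) (l : α → Λ) => l x) (Measure.pi fun _ => μ) :=
    iIndepFun_pi (X := fun _ => id) fun _ => aemeasurable_id
  rw [(iIndepFun_iff_map_fun_eq_pi_map fun i => (measurable_pi_apply (a i)).aemeasurable).1
    (hind.precomp ha)]
  exact congrArg _ (funext fun i => (measurePreserving_eval (fun _ : α => μ) (a i)).map_eq)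

/-- Whatever `u K b` gains over its lower bound, the other values lose. -/
theorem tendsto_of_sub_le_of_sum_eq {γ : Type*} {l : Filter γ} {u : γ → B → ℝ}
    {q : B → ℝ} {ε : γ → ℝ}
    (hε : Tendsto ε l (𝓝 0)) (hle : ∀ᶠ K in l, ∀ b, q b - ε K ≤ u K b)
    (hsum : ∀ᶠ K in l, ∑ b, u K b = ∑ b, q b) (b : B) :
    Tendsto (fun K => u K b) l (𝓝 (q b)) := by
  have hl : Tendsto (fun K => q b - ε K) l (𝓝 (q b)) := by
    simpa using hε.const_sub (q b)
  have hu : Tendsto (fun K => q b + (Finset.univ.erase b).card * ε K) l (𝓝 (q b)) := by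
    simpa using (hε.const_mul ((Finset.univ.erase b).card : ℝ)).const_add (q b)
  refine tendsto_of_tendsto_of_tendsto_of_le_of_le' hl hu (hle.mono fun K h => h b) ?_
  filter_upwards [hle, hsum] with K hK hsumK
  have hrest := Finset.sum_le_sum fun b' (_ : b' ∈ Finset.univ.erase b) => hK b'
  rw [Finset.sum_sub_distrib, Finset.sum_const, nsmul_eq_mul] at hrest
  rw [← Finset.add_sum_erase _ _ (Finset.mem_univ b),
    ← Finset.add_sum_erase _ _ (Finset.mem_univ b)] at hsumK
  linarith

end Measures

/-! ### Exploring a graph -/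

/-- The nodes of the complete `k`-ary tree of depth `d`. They stand for the constraint nodes met
when a graph is explored from an edge. -/
inductive Node (k : ℕ) : ℕ → Type
  | root {d : ℕ} : Node k d
  | cons {d : ℕ} (i : Fin k) (o : Node k d) : Node k (d + 1)

namespace Node

variable {k d : ℕ}

/-- The tree of depth zero has a root only. -/
def equivUnit : Node k 0 ≃ Unit where
  toFun _ := ()
  invFun _ := root
  left_inv | root => rfl
  right_inv _ := rfl

/-- A node of a tree is its root or a node of the subtree of a child. -/
def equivOption : Node k (d + 1) ≃ Option (Fin k × Node k d) where
  toFun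
    | root => none
    | cons i o => some (i, o)
  invFun
    | none => root
    | some (i, o) => cons i o
  left_inv | root => rfl | cons _ _ => rfl
  right_inv | none => rfl | some _ => rfl

instance instFintype : ∀ d, Fintype (Node k d)
  | 0 => Fintype.ofEquiv _ equivUnit.symm
  | d + 1 =>
    have := instFintype d
    Fintype.ofEquiv _ equivOption.symm

theorem prod_succ {M : Type*} [CommMonoid M] (f : Node k (d + 1) → M) :
    ∏ o, f o = f root * ∏ i, ∏ o, f (cons i o) := by
  rw [← equivOption.symm.prod_comp, Fintype.prod_option, Fintype.prod_prod_type]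
  rfl

/-- A labelling of the tree amounts to a label of the root and labellings of the subtrees of its
children. -/
def graft {α : Type*} : α × (Fin k → Node k d → α) ≃ (Node k (d + 1) → α) where
  toFun z
    | root => z.1
    | cons i o => z.2 i o
  invFun W := (W root, fun i o => W (cons i o))
  left_inv _ := rfl
  right_inv _ := funext fun | root => rfl | cons _ _ => rfl

/-- A port of the tree is a node `o` together with `none`, for the socket of `o` that faces the
root, or with `some i`, for the socket that faces the child `i`. The tree edge above `o ≠ root` has
two ends; `o.near` is the one on the same side of the bipartite graph as the root. -/
def near : ∀ {d : ℕ}, Node k d → Node k d × Option (Fin k)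
  | _, root => (root, none)
  | _, cons i root => (root, some i)
  | _, cons i (cons j o) => o.near.map (cons i ∘ cons j) id

/-- The end of the tree edge above `o` on the side of the bipartite graph opposite to the root. -/
def far : ∀ {d : ℕ}, Node k d → Node k d × Option (Fin k)
  | _, root => (root, none)
  | _, cons i o => o.near.map (cons i) id

theorem near_cons_cons (i j : Fin k) (o : Node k d) :
    (cons i (cons j o)).near = (cons j o).far.map (cons i) id := rfl

theorem near_injective : ∀ {d : ℕ}, Function.Injective (near : Node k d → _) := by
  intro d o
  induction o using near.induct with
  | case1 => rintro (_ | ⟨i, _ | _⟩) h <;> simp_all [near, Prod.ext_iff]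
  | case2 => rintro (_ | ⟨i, _ | _⟩) h <;> simp_all [near, Prod.ext_iff]
  | case3 i _ j o ih =>
    rintro (_ | ⟨i', _ | ⟨j', o'⟩⟩) h
    · simp [near, Prod.ext_iff] at h
    · simp [near, Prod.ext_iff] at h
    · obtain ⟨⟨rfl, rfl, h₁⟩, h₂⟩ :
          (i = i' ∧ j = j' ∧ o.near.1 = o'.near.1) ∧ o.near.2 = o'.near.2 := by
        simpa [near, Prod.ext_iff] using h
      rw [ih (Prod.ext h₁ h₂)]

theorem far_injective : Function.Injective (far : Node k d → _) := by
  rintro (_ | ⟨i, o⟩) (_ | ⟨i', o'⟩) h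
  · rfl
  · simp [far, Prod.ext_iff] at h
  · simp [far, Prod.ext_iff] at h
  · obtain ⟨⟨rfl, h₁⟩, h₂⟩ : (i = i' ∧ o.near.1 = o'.near.1) ∧ o.near.2 = o'.near.2 := by
      simpa [far, Prod.ext_iff] using h
    rw [near_injective (Prod.ext h₁ h₂)]

end Node

section Exploration

variable {k K d : ℕ}

/-- The `i`-th of the other sockets of the constraint node to which the socket `s` belongs. -/
def sibling (s : Socket K (k + 1)) (i : Fin k) : Socket K (k + 1) := (s.1, s.2.succAbove i)

/-- The socket at a port of the tree, when `W` gives the sockets that face the root. -/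
def socketAt (W : Node k d → Socket K (k + 1)) (p : Node k d × Option (Fin k)) :
    Socket K (k + 1) :=
  p.2.elim (W p.1) (sibling (W p.1))

/-- The sockets met when the graph with interleaver `f` is explored from the socket `s`. The sides
of the graph alternate along the exploration, hence the inverse. -/
def explore : ∀ {d : ℕ}, Equiv.Perm (Socket K (k + 1)) → Socket K (k + 1) →
    Node k d → Socket K (k + 1)
  | _, _, s, .root => s
  | _, f, s, .cons i o => explore f.symm (f (sibling s i)) o

theorem socketAt_map_cons (W : Node k (d + 1) → Socket K (k + 1)) (i : Fin k)
    (p : Node k d × Option (Fin k)) :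
    socketAt W (p.map (Node.cons i) id) = socketAt (fun o => W (.cons i o)) p := rfl

theorem apply_socketAt_near_explore : ∀ {d : ℕ} (f : Equiv.Perm (Socket K (k + 1)))
    (s : Socket K (k + 1)) (o : Node k d), o ≠ .root →
    f (socketAt (explore f s) o.near) = socketAt (explore f s) o.far
  | _, _, _, .root, h => absurd rfl h
  | _, f, s, .cons i .root, _ => by simp [Node.near, Node.far, explore, socketAt]
  | _, f, s, .cons i (.cons j o), _ => by
    rw [Node.near_cons_cons, Node.far, socketAt_map_cons, socketAt_map_cons, ← f.eq_symm_apply]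
    exact (apply_socketAt_near_explore f.symm (f (sibling s i)) (.cons j o) nofun).symm

theorem explore_eq_of_apply_socketAt_near {f : Equiv.Perm (Socket K (k + 1))}
    {W : Node k d → Socket K (k + 1)}
    (h : ∀ o : Node k d, o ≠ .root → f (socketAt W o.near) = socketAt W o.far) :
    explore f (W .root) = W := by
  induction d generalizing f with
  | zero => exact funext fun o => by cases o; rfl
  | succ d ih =>
    funext o
    obtain _ | ⟨i, o⟩ := o
    · rfl
    · have hi : f (sibling (W .root) i) = W (.cons i .root) := h (.cons i .root) nofun
      rw [explore, hi]
      refine congrFun (ih (W := fun o => W (.cons i o)) fun o' ho' => ?_) o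
      obtain _ | ⟨j, o'⟩ := o'
      · exact absurd rfl ho'
      · exact f.symm_apply_eq.2 (h (.cons i (.cons j o')) nofun).symm

/-- The sockets of a tree belong to distinct constraint nodes. -/
def Spread (W : Node k d → Socket K (k + 1)) : Prop :=
  Function.Injective fun o => (W o).1

theorem fst_socketAt (W : Node k d → Socket K (k + 1)) (p : Node k d × Option (Fin k)) :
    (socketAt W p).1 = (W p.1).1 := by
  obtain ⟨o, _ | i⟩ := p <;> rfl

theorem Spread.socketAt_injective {W : Node k d → Socket K (k + 1)} (hW : Spread W) :
    Function.Injective (socketAt W) := by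
  rintro ⟨o, a⟩ ⟨o', a'⟩ h
  obtain rfl : o = o' := hW (by simpa only [fst_socketAt] using congrArg Prod.fst h)
  cases a <;> cases a' <;> simp_all [socketAt, sibling, Prod.ext_iff]

end Exploration

/-! ### Message passing -/

section MessagePassing

variable {k K d : ℕ} {Λ B : Type*} [MeasurableSpace Λ]

/-- A message passing rule for constraint nodes of degree `k + 1`, with messages in `B`: the
initial message on an edge with label `x` is `init x`, and the message sent in step `d` at the
position `j` of a constraint node is `step d j e x`, where `e` lists the messages that arrive at
the other positions and `x` is the label of the edge. -/
structure MessageRule (k : ℕ) (Λ B : Type*) [MeasurableSpace Λ] where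
  init : Λ → B
  step : ℕ → Fin (k + 1) → (Fin k → B) → Λ → B
  measurableSet_init : ∀ b, MeasurableSet {x | init x = b}
  measurableSet_step : ∀ d j e b, MeasurableSet {x | step d j e x = b}

namespace MessageRule

/-- The message sent after `d` steps at the socket `s`, in the graph whose interleaver from the
side of `s` to the other side is `f`, for the labels `l` of the sockets on the side of `s`. -/
def message (R : MessageRule k Λ B) :
    ℕ → Equiv.Perm (Socket K (k + 1)) → (Socket K (k + 1) → Λ) → Socket K (k + 1) → B
  | 0, _, l, s => R.init (l s)
  | d + 1, f, l, s =>
    R.step d s.2 (fun i => R.message d f.symm (l ∘ f.symm) (f (sibling s i))) (l s)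

/-- The message that arrives at the root of a tree, for the sockets `W` and the labels `L` of its
nodes. -/
def treeMessage (R : MessageRule k Λ B) :
    ∀ d, (Node k d → Socket K (k + 1)) → (Node k d → Λ) → B
  | 0, _, L => R.init (L .root)
  | d + 1, W, L => R.step d (W .root).2
      (fun i => R.treeMessage d (fun o => W (.cons i o)) fun o => L (.cons i o)) (L .root)

theorem message_eq_treeMessage (R : MessageRule k Λ B) (d : ℕ) (f : Equiv.Perm (Socket K (k + 1)))
    (l : Socket K (k + 1) → Λ) (s : Socket K (k + 1)) :
    R.message d f l s =
      R.treeMessage d (explore f s) fun o => l (socketAt (explore f s) o.near) := by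
  induction d generalizing f l s with
  | zero => rfl
  | succ d ih =>
    have hlabel (i : Fin k) (o : Node k d) :
        f.symm (socketAt (explore f.symm (f (sibling s i))) o.near) =
          socketAt (explore f s) (Node.cons i o).near := by
      obtain _ | ⟨j, o⟩ := o
      · simp [Node.near, explore, socketAt]
      · exact apply_socketAt_near_explore f.symm (f (sibling s i)) (.cons j o) nofun
    simp only [message, treeMessage, ih, Function.comp_apply, hlabel]
    rfl

theorem measurableSet_treeMessage [Finite B] (R : MessageRule k Λ B)
    (W : Node k d → Socket K (k + 1)) (b : B) : MeasurableSet {L | R.treeMessage d W L = b} := by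
  induction d generalizing b with
  | zero => exact measurable_pi_apply (X := fun _ : Node k 0 => Λ) .root (R.measurableSet_init b)
  | succ d ih =>
    have hcases : {L | R.treeMessage (d + 1) W L = b} = ⋃ e : Fin k → B,
        {L | R.step d (W .root).2 e (L .root) = b} ∩ ⋂ i, (fun L o => L (.cons i o)) ⁻¹'
          {L | R.treeMessage d (fun o => W (.cons i o)) L = e i} := by
      ext L
      simp [treeMessage, ← funext_iff (f := fun _ => _)]
    rw [hcases]
    exact .iUnion fun e => .inter (measurable_pi_apply (X := fun _ : Node k (d + 1) => Λ) .root
      (R.measurableSet_step d _ e b)) (.iInter fun i => measurable_pi_lambda _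
        (fun o => measurable_pi_apply _) (ih _ _))

theorem measurableSet_message [Finite B] (R : MessageRule k Λ B)
    (f : Equiv.Perm (Socket K (k + 1))) (s : Socket K (k + 1)) (b : B) :
    MeasurableSet {l | R.message d f l s = b} := by
  simp_rw [message_eq_treeMessage]
  exact (measurable_pi_lambda (fun (l : Socket K (k + 1) → Λ) (o : Node k d) =>
    l (socketAt (explore f s) o.near)) fun o => measurable_pi_apply _)
      (R.measurableSet_treeMessage _ b)

theorem measureReal_message_of_spread [Finite B] (R : MessageRule k Λ B) {μ : Measure Λ}
    [IsProbabilityMeasure μ] {f : Equiv.Perm (Socket K (k + 1))} {s : Socket K (k + 1)}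
    (hs : Spread (explore f s : Node k d → _)) (b : B) :
    (Measure.pi fun _ => μ).real {l | R.message d f l s = b} =
      (Measure.pi fun _ => μ).real {L | R.treeMessage d (explore f s) L = b} := by
  simp_rw [message_eq_treeMessage]
  exact (measurePreserving_comp_injective μ
    (hs.socketAt_injective.comp Node.near_injective)).measureReal_preimage
      (R.measurableSet_treeMessage _ b).nullMeasurableSet

end MessageRule

theorem measurePreserving_graft (μ : Measure Λ) [SigmaFinite μ] :
    MeasurePreserving (Node.graft : Λ × (Fin k → Node k d → Λ) → _)
      (μ.prod (Measure.pi fun _ => Measure.pi fun _ => μ)) (Measure.pi fun _ => μ) := by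
  have hm : Measurable (Node.graft : Λ × (Fin k → Node k d → Λ) → Node k (d + 1) → Λ) := by
    refine measurable_pi_lambda _ fun o => ?_
    obtain _ | ⟨i, o⟩ := o
    · exact measurable_fst
    · exact (measurable_pi_apply o).comp ((measurable_pi_apply i).comp measurable_snd)
  refine ⟨hm, (Measure.pi_eq fun s hs => ?_).symm⟩
  have hbox : (Node.graft : Λ × (Fin k → Node k d → Λ) → _) ⁻¹' Set.univ.pi s =
      s .root ×ˢ Set.univ.pi fun i => Set.univ.pi fun o => s (.cons i o) := by
    ext z
    simp only [Set.mem_preimage, Set.mem_univ_pi, Set.mem_prod]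
    exact ⟨fun h => ⟨h .root, fun i o => h (.cons i o)⟩,
      fun h o => match o with
        | .root => h.1
        | .cons i o => h.2 i o⟩
  rw [Measure.map_apply hm (.univ_pi hs), hbox, Measure.prod_prod, Measure.pi_pi, Node.prod_succ]
  simp_rw [Measure.pi_pi]

namespace MessageRule

variable [Fintype B] (R : MessageRule k Λ B) (μ : Measure Λ)

/-- The law of the message after `d` steps of density evolution: the messages that a constraint
node combines are independent, and the position of the outgoing message is uniform. -/
def evolve : ℕ → B → ℝ
  | 0, b => μ.real {x | R.init x = b}
  | d + 1, b => 𝔼 j : Fin (k + 1), ∑ e : Fin k → B,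
      μ.real {x | R.step d j e x = b} * ∏ i, evolve d (e i)

/-- The law of the message after `d` steps at a uniformly random socket of a uniformly random
graph with `K` constraint nodes on each side, for independent labels of law `μ`. -/
def avgLaw (K d : ℕ) (b : B) : ℝ :=
  𝔼 z : Equiv.Perm (Socket K (k + 1)) × Socket K (k + 1),
    (Measure.pi fun _ => μ).real {l | R.message d z.1 l z.2 = b}

variable [IsProbabilityMeasure μ]

theorem measureReal_treeMessage_succ (W : Node k (d + 1) → Socket K (k + 1)) (b : B) :
    (Measure.pi fun _ => μ).real {L | R.treeMessage (d + 1) W L = b} =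
      ∑ e : Fin k → B, μ.real {x | R.step d (W .root).2 e x = b} * ∏ i,
        (Measure.pi fun _ => μ).real {L | R.treeMessage d (fun o => W (.cons i o)) L = e i} := by
  have hcases : Node.graft ⁻¹' {L | R.treeMessage (d + 1) W L = b} =
      ⋃ e ∈ (Finset.univ : Finset (Fin k → B)), {x | R.step d (W .root).2 e x = b} ×ˢ
        Set.univ.pi fun i => {L | R.treeMessage d (fun o => W (.cons i o)) L = e i} := by
    ext z
    constructor
    · exact fun h => Set.mem_biUnion (Finset.mem_univ fun i =>
        R.treeMessage d (fun o => W (.cons i o)) (z.2 i)) ⟨h, fun _ _ => rfl⟩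
    · intro h
      obtain ⟨e, -, hroot, hchildren⟩ := Set.mem_iUnion₂.1 h
      obtain rfl : (fun i => R.treeMessage d (fun o => W (.cons i o)) (z.2 i)) = e :=
        funext fun i => hchildren i trivial
      exact hroot
  rw [← (measurePreserving_graft μ).measureReal_preimage
    (R.measurableSet_treeMessage W b).nullMeasurableSet, hcases, measureReal_biUnion_finset]
  · refine Finset.sum_congr rfl fun e _ => ?_
    rw [measureReal_prod_prod, measureReal_def (μ := Measure.pi _), Measure.pi_pi,
      ENNReal.toReal_prod]
    rfl
  · exact fun e _ e' _ hne => Set.disjoint_left.2 fun z hz hz' =>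
      hne (funext fun i => (hz.2 i trivial).symm.trans (hz'.2 i trivial))
  · exact fun e _ => (R.measurableSet_step _ _ _ _).prod (.univ_pi fun i =>
      R.measurableSet_treeMessage _ _)

theorem expect_measureReal_treeMessage [NeZero K] (d : ℕ) (b : B) :
    𝔼 W : Node k d → Socket K (k + 1),
      (Measure.pi fun _ => μ).real {L | R.treeMessage d W L = b} = R.evolve μ d b := by
  induction d generalizing b with
  | zero =>
    have hroot (W : Node k 0 → Socket K (k + 1)) :
        (Measure.pi fun _ => μ).real {L | R.treeMessage 0 W L = b} = R.evolve μ 0 b :=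
      (measurePreserving_eval (fun _ : Node k 0 => μ) .root).measureReal_preimage
        (R.measurableSet_init b).nullMeasurableSet
    simp_rw [hroot, Fintype.expect_const]
  | succ d ih =>
    set p : (Node k d → Socket K (k + 1)) → B → ℝ := fun W b =>
      (Measure.pi fun _ => μ).real {L | R.treeMessage d W L = b}
    calc 𝔼 W : Node k (d + 1) → Socket K (k + 1),
          (Measure.pi fun _ => μ).real {L | R.treeMessage (d + 1) W L = b}
        = 𝔼 s : Socket K (k + 1), 𝔼 T : Fin k → Node k d → Socket K (k + 1),
            ∑ e : Fin k → B, μ.real {x | R.step d s.2 e x = b} * ∏ i, p (T i) (e i) := by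
          rw [← Finset.expect_product', Finset.univ_product_univ]
          refine (Fintype.expect_equiv Node.graft _ _ fun z => ?_).symm
          exact (R.measureReal_treeMessage_succ μ (Node.graft z) b).symm
      _ = 𝔼 s : Socket K (k + 1), ∑ e : Fin k → B,
            μ.real {x | R.step d s.2 e x = b} * ∏ i, R.evolve μ d (e i) := by
          refine Finset.expect_congr rfl fun s _ => ?_
          rw [Finset.expect_sum_comm]
          refine Finset.sum_congr rfl fun e _ => ?_
          rw [← Finset.mul_expect, expect_pi_prod fun i W => p W (e i)]
          simp_rw [p, ih]
      _ = R.evolve μ (d + 1) b :=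
          expect_snd fun j => ∑ e : Fin k → B,
            μ.real {x | R.step d j e x = b} * ∏ i, R.evolve μ d (e i)

theorem sum_evolve (d : ℕ) : ∑ b, R.evolve μ d b = 1 := by
  rw [← Finset.sum_congr rfl fun b _ => R.expect_measureReal_treeMessage (K := 1) μ d b,
    ← Finset.expect_sum_comm]
  simp_rw [sum_measureReal_eq_one fun b => R.measurableSet_treeMessage _ b]
  exact Fintype.expect_one

theorem sum_avgLaw [NeZero K] (d : ℕ) : ∑ b, R.avgLaw μ K d b = 1 := by
  simp_rw [avgLaw, ← Finset.expect_sum_comm,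
    sum_measureReal_eq_one fun b => R.measurableSet_message _ _ b]
  exact Fintype.expect_one

end MessageRule

theorem card_le_card_explore_mul {W : Node k d → Socket K (k + 1)} (hW : Spread W) :
    Fintype.card (Equiv.Perm (Socket K (k + 1)) × Socket K (k + 1)) ≤
      Fintype.card {z : Equiv.Perm (Socket K (k + 1)) × Socket K (k + 1) //
        explore z.1 z.2 = W} * Fintype.card (Node k d → Socket K (k + 1)) := by
  let S := Socket K (k + 1)
  let Edge := {o : Node k d // o ≠ .root}
  have hEdge : Fintype.card (Node k d) = Fintype.card Edge + 1 := by
    rw [Fintype.card_subtype_compl, Fintype.card_subtype_eq]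
    exact (Nat.succ_pred_eq_of_pos (Fintype.card_pos_iff.2 ⟨.root⟩)).symm
  have hnear : Function.Injective fun o : Edge => socketAt W o.1.near :=
    (hW.socketAt_injective.comp Node.near_injective).comp Subtype.val_injective
  have hfar : Function.Injective fun o : Edge => socketAt W o.1.far :=
    (hW.socketAt_injective.comp Node.far_injective).comp Subtype.val_injective
  have hexplore : Fintype.card {f : Equiv.Perm S // ∀ o : Edge,
        f (socketAt W o.1.near) = socketAt W o.1.far} ≤
      Fintype.card {z : Equiv.Perm S × S // explore z.1 z.2 = W} :=
    Fintype.card_le_of_injective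
      (fun f => ⟨(f.1, W .root), explore_eq_of_apply_socketAt_near fun o ho => f.2 ⟨o, ho⟩⟩)
      fun f f' h => by simpa [Subtype.ext_iff] using h
  calc Fintype.card (Equiv.Perm S × S)
      = Fintype.card (Equiv.Perm S) * Fintype.card S := Fintype.card_prod _ _
    _ ≤ Fintype.card {z : Equiv.Perm S × S // explore z.1 z.2 = W} *
          Fintype.card S ^ Fintype.card Edge * Fintype.card S := by
        gcongr
        exact (card_perm_le_card_prescribed_mul_pow hnear hfar).trans (by gcongr)
    _ = _ := by rw [Fintype.card_fun, hEdge, pow_succ, mul_assoc]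

theorem tendsto_expect_not_spread (k d : ℕ) :
    Tendsto (fun K : ℕ => 𝔼 W : Node k d → Socket K (k + 1), if Spread W then (0 : ℝ) else 1)
      atTop (𝓝 0) :=
  (tendsto_expect_not_injective (Node k d)).congr fun _ => by
    convert (expect_fst_comp (β := Fin (k + 1)) fun x =>
      if Function.Injective x then (0 : ℝ) else 1).symm using 3
    exact Iff.rfl

namespace MessageRule

variable [Fintype B] (R : MessageRule k Λ B) (μ : Measure Λ) [IsProbabilityMeasure μ]

theorem evolve_sub_le_avgLaw [NeZero K] (d : ℕ) (b : B) :
    R.evolve μ d b - (𝔼 W : Node k d → Socket K (k + 1), if Spread W then (0 : ℝ) else 1) ≤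
      R.avgLaw μ K d b := by
  set p : (Node k d → Socket K (k + 1)) → ℝ := fun W =>
    (Measure.pi fun _ => μ).real {L | R.treeMessage d W L = b}
  calc R.evolve μ d b - (𝔼 W : Node k d → Socket K (k + 1), if Spread W then (0 : ℝ) else 1)
      = 𝔼 W, (p W - if Spread W then 0 else 1) := by
        rw [← R.expect_measureReal_treeMessage (K := K) μ d b, ← Finset.expect_sub_distrib]
    _ ≤ 𝔼 W, if Spread W then p W else 0 := by
        refine Finset.expect_le_expect fun W _ => ?_
        split_ifs
        · rw [sub_zero]
        · exact sub_nonpos.2 measureReal_le_one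
    _ ≤ 𝔼 z : Equiv.Perm (Socket K (k + 1)) × Socket K (k + 1),
          if Spread (explore z.1 z.2 : Node k d → _) then p (explore z.1 z.2) else 0 := by
        refine expect_le_expect_comp (F := fun W => if Spread W then p W else 0)
          (fun z : Equiv.Perm (Socket K (k + 1)) × Socket K (k + 1) => explore z.1 z.2)
          (fun W => ?_) fun W hW => card_le_card_explore_mul (ite_ne_right_iff.1 hW).1
        split_ifs
        · exact measureReal_nonneg
        · exact le_rfl
    _ ≤ R.avgLaw μ K d b := by
        refine Finset.expect_le_expect fun z _ => ?_
        split_ifs with hz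
        · exact (R.measureReal_message_of_spread hz b).ge
        · exact measureReal_nonneg

theorem tendsto_avgLaw (d : ℕ) (b : B) :
    Tendsto (fun K => R.avgLaw μ K d b) atTop (𝓝 (R.evolve μ d b)) := by
  refine tendsto_of_sub_le_of_sum_eq (tendsto_expect_not_spread k d) ?_ ?_ b
  · filter_upwards [eventually_ne_atTop 0] with K hK b
    have : NeZero K := ⟨hK⟩
    exact R.evolve_sub_le_avgLaw μ d b
  · filter_upwards [eventually_ne_atTop 0] with K hK
    have : NeZero K := ⟨hK⟩
    rw [R.sum_avgLaw, R.sum_evolve]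

end MessageRule

end MessagePassing

/-! ### Bounded distance decoding -/

theorem eq_zero_or_eq_one (a : ZMod 2) : a = 0 ∨ a = 1 := by
  decide +revert

section Decoding

variable {n : ℕ} {C : Submodule (ZMod 2) (Fin n → ZMod 2)} {t : ℕ}

theorem eq_of_hammingDist_le (ht : t ≤ (minDist C - 1) / 2) {c c' w : Fin n → ZMod 2} (hc : c ∈ C)
    (hc' : c' ∈ C) (h : hammingDist c w ≤ t) (h' : hammingDist c' w ≤ t) : c = c' := by
  by_contra hne
  have hmin : minDist C ≤ hammingDist c c' := Nat.sInf_le ⟨c, hc, c', hc', hne, rfl⟩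
  have hpos : 0 < hammingDist c c' := hammingDist_pos.2 hne
  have htri := hammingDist_triangle_right c c' w
  omega

/-- Some codeword within distance `t` of `w` has the value `b` at position `j`. -/
def DecodesTo (C : Submodule (ZMod 2) (Fin n → ZMod 2)) (t : ℕ) (w : Fin n → ZMod 2) (j : Fin n)
    (b : ZMod 2) : Prop :=
  ∃ c ∈ C, hammingDist c w ≤ t ∧ c j = b

theorem bddOut_eq_ite (w : Fin n → ZMod 2) (j : Fin n) :
    bddOut C t w j =
      if DecodesTo C t w j 0 then 1 else if DecodesTo C t w j 1 then -1 else 0 := by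
  unfold bddOut
  congr

theorem DecodesTo.eq (ht : t ≤ (minDist C - 1) / 2) {w : Fin n → ZMod 2} {j : Fin n}
    {b b' : ZMod 2} : DecodesTo C t w j b → DecodesTo C t w j b' → b = b' := by
  rintro ⟨c, hc, hd, rfl⟩ ⟨c', hc', hd', rfl⟩
  rw [eq_of_hammingDist_le ht hc hc' hd hd']

theorem DecodesTo.add {c : Fin n → ZMod 2} (hc : c ∈ C) {w : Fin n → ZMod 2} {j : Fin n}
    {b : ZMod 2} : DecodesTo C t w j b → DecodesTo C t (c + w) j (c j + b) := by
  rintro ⟨c', hc', hd, rfl⟩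
  refine ⟨c + c', C.add_mem hc hc', ?_, rfl⟩
  rwa [hammingDist_eq_hammingNorm, neg_add_rev, add_assoc, neg_add_cancel_left,
    ← hammingDist_eq_hammingNorm]

theorem decodesTo_add_iff {c : Fin n → ZMod 2} (hc : c ∈ C) {w : Fin n → ZMod 2} {j : Fin n}
    {b : ZMod 2} : DecodesTo C t (c + w) j (c j + b) ↔ DecodesTo C t w j b :=
  ⟨fun h => by
    simpa only [Pi.neg_apply, neg_add_cancel_left] using h.add (C.neg_mem hc), .add hc⟩

theorem bddOut_add (ht : t ≤ (minDist C - 1) / 2) {c : Fin n → ZMod 2} (hc : c ∈ C)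
    (w : Fin n → ZMod 2) (j : Fin n) :
    bddOut C t (c + w) j = if c j = 0 then bddOut C t w j else -bddOut C t w j := by
  have hadd (b : ZMod 2) := decodesTo_add_iff (t := t) hc (w := w) (j := j) (b := b)
  obtain hj | hj := eq_zero_or_eq_one (c j)
  · simp only [hj, zero_add] at hadd
    simp only [bddOut_eq_ite, hadd, hj, if_true]
  · have hadd₀ := hadd 1
    have hadd₁ := hadd 0
    have hne : DecodesTo C t w j 0 → ¬DecodesTo C t w j 1 := fun h₀ h₁ =>
      zero_ne_one (h₀.eq ht h₁)
    rw [hj, CharTwo.add_self_eq_zero] at hadd₀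
    rw [hj, add_zero] at hadd₁
    rw [bddOut_eq_ite, bddOut_eq_ite, hadd₀, hadd₁, hj, if_neg one_ne_zero]
    split_ifs with h₁ h₀ <;> simp_all

theorem bddOut_zero (j : Fin n) : bddOut C t 0 j = 1 :=
  if_pos ⟨0, C.zero_mem, by simp, rfl⟩

end Decoding

/-! ### The rates of the outcomes of extrinsic bounded distance decoding -/

section Rates

variable {n : ℕ}

/-- Probability that the word received for the all-zero codeword agrees with `w` at the positions
other than `j`, when these positions are in error independently with probability `x`. -/
def errorProb (x : ℝ) (j : Fin n) (w : Fin n → ZMod 2) : ℝ :=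
  ∏ i ∈ Finset.univ.erase j, if w i = 1 then x else 1 - x

/-- The word with the value `r` at `j` and errors at the positions in `S`. -/
def errorWord (j : Fin n) (r : ZMod 2) (S : Finset (Fin n)) : Fin n → ZMod 2 :=
  fun i => if i = j then r else if i ∈ S then 1 else 0

theorem sum_apply_eq_sum_errorWord (j : Fin n) (r : ZMod 2) (F : (Fin n → ZMod 2) → ℝ) :
    ∑ w with w j = r, F w = ∑ S ∈ (Finset.univ.erase j).powerset, F (errorWord j r S) := by
  have hword {w : Fin n → ZMod 2} (hw : w j = r) :
      errorWord j r {i ∈ Finset.univ.erase j | w i = 1} = w := by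
    funext i
    obtain rfl | hi := eq_or_ne i j
    · simp [errorWord, hw]
    · obtain h | h := eq_zero_or_eq_one (w i) <;> simp [errorWord, hi, h]
  refine Finset.sum_nbij' (fun w => {i ∈ Finset.univ.erase j | w i = 1}) (errorWord j r)
    ?_ ?_ ?_ ?_ ?_
  · exact fun w _ => Finset.mem_powerset.2 (Finset.filter_subset _ _)
  · exact fun S _ => by simp [errorWord]
  · exact fun w hw => hword (Finset.mem_filter.1 hw).2
  · intro S hS
    ext i
    have hSj : i ∈ S → i ≠ j := fun hi => Finset.ne_of_mem_erase (Finset.mem_powerset.1 hS hi)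
    rw [Finset.mem_filter, Finset.mem_erase, errorWord]
    by_cases hi : i ∈ S
    · simp [hi, hSj hi]
    · simp +contextual [hi]
  · exact fun w hw => by rw [hword (Finset.mem_filter.1 hw).2]

theorem errorProb_errorWord (x : ℝ) {j : Fin n} (r : ZMod 2) {S : Finset (Fin n)}
    (hS : S ⊆ Finset.univ.erase j) :
    errorProb x j (errorWord j r S) = x ^ S.card * (1 - x) ^ (n - 1 - S.card) := by
  have hprod : errorProb x j (errorWord j r S) =
      ∏ i ∈ Finset.univ.erase j, if i ∈ S then x else 1 - x := by
    refine Finset.prod_congr rfl fun i hi => ?_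
    by_cases h : i ∈ S <;> simp [errorWord, Finset.ne_of_mem_erase hi, h]
  rw [hprod, Finset.prod_ite, Finset.prod_const, Finset.prod_const, Finset.filter_mem_eq_inter,
    Finset.inter_eq_right.2 hS, Finset.filter_notMem_eq_sdiff, Finset.card_sdiff_of_subset hS,
    Finset.card_erase_of_mem (Finset.mem_univ j), Finset.card_univ, Fintype.card_fin]

theorem sum_errorProb (x : ℝ) (j : Fin n) (r : ZMod 2) : ∑ w with w j = r, errorProb x j w = 1 := by
  have hcard : (Finset.univ.erase j).card = n - 1 := by simp
  rw [sum_apply_eq_sum_errorWord,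
    Finset.sum_congr rfl fun S hS => errorProb_errorWord x r (Finset.mem_powerset.1 hS), ← hcard,
    Finset.sum_pow_mul_eq_add_pow, add_sub_cancel, one_pow]

theorem errorProb_pos {x : ℝ} (hx : x ∈ Set.Ioo (0 : ℝ) 1) (j : Fin n) (w : Fin n → ZMod 2) :
    0 < errorProb x j w :=
  Finset.prod_pos fun i _ => by
    split_ifs
    · exact hx.1
    · exact sub_pos.2 hx.2

variable (C : Submodule (ZMod 2) (Fin n → ZMod 2)) (t : ℕ)

/-- Probability that position `j` of the all-zero codeword, received as `r`, is decoded to `s`, when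
the other positions are received in error independently with probability `x`. -/
def outRateAt (x : ℝ) (r : ZMod 2) (s : SignType) (j : Fin n) : ℝ :=
  ∑ w with w j = r ∧ bddOut C t w j = s, errorProb x j w

/-- The average of `outRateAt` over the positions. -/
def outRate (x : ℝ) (r : ZMod 2) (s : SignType) : ℝ :=
  𝔼 j, outRateAt C t x r s j

theorem sum_outRateAt (x : ℝ) (r : ZMod 2) (j : Fin n) : ∑ s, outRateAt C t x r s j = 1 := by
  simp_rw [outRateAt, ← Finset.filter_filter]
  rw [Finset.sum_fiberwise, sum_errorProb]

theorem sum_outRate [NeZero n] (x : ℝ) (r : ZMod 2) : ∑ s, outRate C t x r s = 1 := by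
  simp_rw [outRate, ← Finset.expect_sum_comm, sum_outRateAt]
  exact Fintype.expect_one

variable {C t}

theorem outRate_nonneg {x : ℝ} (hx : x ∈ Set.Ioo (0 : ℝ) 1) (r : ZMod 2) (s : SignType) :
    0 ≤ outRate C t x r s :=
  Finset.expect_nonneg fun _ _ => Finset.sum_nonneg fun _ _ => (errorProb_pos hx _ _).le

theorem outRate_pos_iff {x : ℝ} (hx : x ∈ Set.Ioo (0 : ℝ) 1) {r : ZMod 2} {s : SignType} :
    0 < outRate C t x r s ↔ ∃ (w : Fin n → ZMod 2) (j : Fin n), w j = r ∧ bddOut C t w j = s := by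
  have hat (j : Fin n) : 0 ≤ outRateAt C t x r s j :=
    Finset.sum_nonneg fun _ _ => (errorProb_pos hx _ _).le
  constructor
  · intro h
    obtain ⟨j, -, hj⟩ := Finset.exists_ne_zero_of_expect_ne_zero h.ne'
    obtain ⟨w, hw, -⟩ := Finset.exists_ne_zero_of_sum_ne_zero hj
    exact ⟨w, j, (Finset.mem_filter.1 hw).2⟩
  · rintro ⟨w, j, hw⟩
    refine Finset.expect_pos' (fun j _ => hat j) ⟨j, Finset.mem_univ j, ?_⟩
    exact Finset.sum_pos (fun _ _ => errorProb_pos hx _ _)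
      ⟨w, Finset.mem_filter.2 ⟨Finset.mem_univ w, hw⟩⟩

/-- Adding a codeword with a one at the position exchanges the two outcomes that the combining rule
compares. -/
theorem outRate_pos_swap (hC : ∀ j, ∃ c ∈ C, c j = 1) (ht : t ≤ (minDist C - 1) / 2) {x : ℝ}
    (hx : x ∈ Set.Ioo (0 : ℝ) 1) {r : ZMod 2} {s : SignType} (h : 0 < outRate C t x r s) :
    0 < outRate C t x (r + 1) (-s) := by
  obtain ⟨w, j, rfl, rfl⟩ := (outRate_pos_iff hx).1 h
  obtain ⟨c, hc, hj⟩ := hC j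
  refine (outRate_pos_iff hx).2 ⟨c + w, j, by simp [hj, add_comm], ?_⟩
  rw [bddOut_add ht hc, hj, if_neg one_ne_zero]

theorem outRate_zero_one_pos [NeZero n] {x : ℝ} (hx : x ∈ Set.Ioo (0 : ℝ) 1) :
    0 < outRate C t x 0 1 :=
  (outRate_pos_iff hx).2 ⟨0, 0, rfl, bddOut_zero 0⟩

theorem two_mul_card_codewords (hC : ∀ j, ∃ c ∈ C, c j = 1) (j : Fin n) (b : ZMod 2) :
    2 * (Finset.univ.filter fun c : Fin n → ZMod 2 => c ∈ C ∧ c j = b).card =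
      (Finset.univ.filter fun c : Fin n → ZMod 2 => c ∈ C).card := by
  have hcoset (b' : ZMod 2) :
      (Finset.univ.filter fun c : Fin n → ZMod 2 => c ∈ C ∧ c j = b').card =
        (Finset.univ.filter fun c : Fin n → ZMod 2 => c ∈ C ∧ c j = b).card := by
    obtain ⟨a, ha, haj⟩ : ∃ a ∈ C, a j = b - b' := by
      obtain h | h := eq_zero_or_eq_one (b - b')
      · exact ⟨0, C.zero_mem, h.symm⟩
      · exact h ▸ hC j
    refine Finset.card_equiv (Equiv.addLeft a) fun c => ?_
    simp [C.add_mem_iff_right ha, haj, ← eq_sub_iff_add_eq']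
  rw [Finset.card_eq_sum_card_fiberwise (s := Finset.univ.filter fun c => c ∈ C)
    (f := fun c => c j) fun _ _ => Finset.mem_univ _]
  simp_rw [Finset.filter_filter, hcoset, Finset.sum_const, Finset.card_univ, ZMod.card, smul_eq_mul]

/-- By linearity and the symmetry of the decoder, the transmitted codeword may be taken to be
zero. -/
theorem outProb_eq_outRate (hC : ∀ j, ∃ c ∈ C, c j = 1) (ht : t ≤ (minDist C - 1) / 2) (x : ℝ)
    (b r : ZMod 2) (s : SignType) :
    outProb C t x b r s = outRate C t x (r - b) (if b = 0 then s else -s) := by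
  have hcodeword {j : Fin n} {c : Fin n → ZMod 2} (hc : c ∈ C ∧ c j = b) :
      ∑ e : Fin n → ZMod 2 with c j + e j = r ∧ bddOut C t (c + e) j = s,
        ∏ i ∈ Finset.univ.erase j, (if e i = 1 then x else 1 - x) =
          outRateAt C t x (r - b) (if b = 0 then s else -s) j := by
    refine Finset.sum_congr (Finset.filter_congr fun e _ => ?_) fun _ _ => rfl
    rw [hc.2, ← eq_sub_iff_add_eq', bddOut_add ht hc.1, hc.2]
    split_ifs
    · rfl
    · rw [neg_eq_iff_eq_neg]
  have hcard (j : Fin n) :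
      ((Finset.univ.filter fun c : Fin n → ZMod 2 => c ∈ C ∧ c j = b).card : ℝ) =
        (Finset.univ.filter fun c : Fin n → ZMod 2 => c ∈ C).card / 2 := by
    rw [eq_div_iff two_ne_zero, mul_comm]
    exact_mod_cast two_mul_card_codewords hC j b
  have hpos : ((Finset.univ.filter fun c : Fin n → ZMod 2 => c ∈ C).card / 2 : ℝ) ≠ 0 := by
    have : 0 < (Finset.univ.filter fun c : Fin n → ZMod 2 => c ∈ C).card :=
      Finset.card_pos.2 ⟨0, by simp⟩
    positivity
  rw [outProb, outRate, Fintype.expect_eq_sum_div_card]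
  simp_rw [hcard, Finset.sum_congr rfl fun _ hc => hcodeword (Finset.mem_filter.1 hc).2,
    Finset.sum_const, nsmul_eq_mul, hcard, ← Finset.mul_sum]
  rw [Finset.card_univ, mul_comm (Fintype.card _ : ℝ), mul_div_mul_left _ _ hpos]

theorem outRateAt_eq_sum_card (x : ℝ) (r : ZMod 2) (s : SignType) (j : Fin n) :
    outRateAt C t x r s j = ∑ i ∈ Finset.range n, x ^ i * (1 - x) ^ (n - i - 1) *
      {S ∈ (Finset.univ.erase j).powersetCard i | bddOut C t (errorWord j r S) j = s}.card := by
  rw [outRateAt, ← Finset.filter_filter, Finset.sum_filter, sum_apply_eq_sum_errorWord,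
    Finset.sum_powerset, Finset.card_erase_of_mem (Finset.mem_univ j), Finset.card_univ,
    Fintype.card_fin, Nat.sub_add_cancel j.pos]
  refine Finset.sum_congr rfl fun i _ => ?_
  rw [← Finset.sum_filter, mul_comm, ← nsmul_eq_mul, ← Finset.sum_const]
  refine Finset.sum_congr rfl fun S hS => ?_
  obtain ⟨hS', rfl⟩ := Finset.mem_powersetCard.1 (Finset.mem_filter.1 hS).1
  rw [errorProb_errorWord x r hS', Nat.sub_right_comm]

theorem decProb_eq_expect (r : ZMod 2) (s : SignType) (i : ℕ) :
    decProb C t r s i = 𝔼 j, ({S ∈ (Finset.univ.erase j).powersetCard i |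
      bddOut C t (errorWord j r S) j = s}.card / (n - 1).choose i : ℝ) := by
  rw [Fintype.expect_eq_sum_div_card, Fintype.card_fin]
  rfl

theorem binAvg_decProb (x : ℝ) (r : ZMod 2) (s : SignType) :
    binAvg n (decProb C t r s) x = outRate C t x r s := by
  simp_rw [binAvg, outRate, outRateAt_eq_sum_card, Finset.expect_sum_comm]
  refine Finset.sum_congr rfl fun i hi => ?_
  have hchoose : ((n - 1).choose i : ℝ) ≠ 0 := by
    exact_mod_cast (Nat.choose_pos (Nat.le_sub_one_of_lt (Finset.mem_range.1 hi))).ne'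
  rw [decProb_eq_expect, Finset.mul_expect]
  refine Finset.expect_congr rfl fun j _ => ?_
  field_simp

theorem sum_decProb {i : ℕ} (hi : i < n) (r : ZMod 2) : ∑ s, decProb C t r s i = 1 := by
  have hchoose : ((n - 1).choose i : ℝ) ≠ 0 := by
    exact_mod_cast (Nat.choose_pos (Nat.le_sub_one_of_lt hi)).ne'
  have hn : Nonempty (Fin n) := ⟨⟨i, hi⟩⟩
  have hcard (j : Fin n) : ∑ s, {S ∈ (Finset.univ.erase j).powersetCard i |
      bddOut C t (errorWord j r S) j = s}.card = (n - 1).choose i := by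
    rw [← Finset.card_eq_sum_card_fiberwise fun _ _ => Finset.mem_univ _,
      Finset.card_powersetCard, Finset.card_erase_of_mem (Finset.mem_univ j), Finset.card_univ,
      Fintype.card_fin]
  simp_rw [decProb_eq_expect, ← Finset.expect_sum_comm, ← Finset.sum_div, ← Nat.cast_sum, hcard,
    div_self hchoose]
  exact Fintype.expect_one

theorem binAvg_one_sub_decProb (x : ℝ) (r : ZMod 2) :
    binAvg n (fun i => 1 - decProb C t r (-1) i - decProb C t r 1 i) x = outRate C t x r 0 := by
  rw [← binAvg_decProb]
  refine Finset.sum_congr rfl fun i hi => ?_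
  have hsum : decProb C t r 0 i + (decProb C t r (-1) i + (decProb C t r 1 i + 0)) = 1 :=
    sum_decProb (Finset.mem_range.1 hi) r
  congr 1
  linarith

end Rates

/-! ### The symmetrized channel -/

section Channel

variable {m : ℕ} {σ : ℝ}

theorem mean_pos (hm : 1 ≤ m) (hσ : σ ≠ 0) (j : ℕ) : 0 < mean m σ j := by
  have hM : (2 : ℝ) ≤ 2 ^ m := le_self_pow₀ one_le_two (by omega)
  have hΔ : 0 < Delta m := Real.sqrt_pos.2 (div_pos three_pos (by nlinarith))
  unfold mean
  positivity

theorem var_eq_two_mul_mean (m : ℕ) (σ : ℝ) (j : ℕ) : var m σ j = 2 * mean m σ j := by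
  unfold var mean
  ring

theorem var_pos (hm : 1 ≤ m) (hσ : σ ≠ 0) (j : ℕ) : 0 < var m σ j :=
  var_eq_two_mul_mean m σ j ▸ mul_pos two_pos (mean_pos hm hσ j)

theorem weight_nonneg (m j : ℕ) : 0 ≤ weight m j := by
  have hone : (1 : ℝ) ≤ 2 ^ (m - Nat.clog 2 (j + 1)) := one_le_pow₀ one_le_two
  exact div_nonneg (mul_nonneg zero_le_two (sub_nonneg.2 hone)) (by positivity)

theorem weight_zero_pos (hm : 1 ≤ m) : 0 < weight m 0 := by
  have hM : (2 : ℝ) ≤ 2 ^ m := le_self_pow₀ one_le_two (by omega)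
  rw [weight, zero_add, Nat.clog_one_right, Nat.sub_zero]
  exact div_pos (by linarith) (by positivity)

theorem clog_two_pow_add {q i : ℕ} (hi : i < 2 ^ q) : Nat.clog 2 (2 ^ q + i + 1) = q + 1 :=
  le_antisymm (Nat.clog_le_of_le_pow (by rw [pow_succ]; omega))
    ((Nat.lt_clog_iff_pow_lt one_lt_two).2 (by omega))

theorem sum_two_pow_sub_clog {p q : ℕ} (hq : q ≤ p) :
    ∑ j ∈ Finset.range (2 ^ q), (2 : ℝ) ^ (p + 1 - Nat.clog 2 (j + 1)) =
      2 ^ (p + 1) + q * 2 ^ p := by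
  induction q with
  | zero => simp
  | succ q ih =>
    have hblock : ∑ i ∈ Finset.range (2 ^ q), (2 : ℝ) ^ (p + 1 - Nat.clog 2 (2 ^ q + i + 1)) =
        2 ^ p := by
      rw [Finset.sum_congr rfl fun i hi => by rw [clog_two_pow_add (Finset.mem_range.1 hi)],
        Finset.sum_const, Finset.card_range, nsmul_eq_mul, Nat.cast_pow, Nat.cast_ofNat,
        ← pow_add, show q + (p + 1 - (q + 1)) = p by omega]
    rw [pow_succ 2 q, mul_two, Finset.sum_range_add, ih (by omega), hblock]
    push_cast
    ring

theorem sum_weight (hm : 1 ≤ m) : ∑ j ∈ Finset.range (2 ^ m / 2), weight m j = 1 := by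
  obtain ⟨p, rfl⟩ : ∃ p, m = p + 1 := ⟨m - 1, by omega⟩
  have hhalf : 2 ^ (p + 1) / 2 = 2 ^ p := by rw [pow_succ, Nat.mul_div_cancel _ two_pos]
  simp only [weight]
  rw [hhalf, ← Finset.sum_div, ← Finset.mul_sum, Finset.sum_sub_distrib,
    sum_two_pow_sub_clog le_rfl, Finset.sum_const, Finset.card_range, nsmul_eq_mul,
    div_eq_one_iff_eq (by positivity)]
  push_cast
  ring

theorem gaussianPDFReal_neg_neg (μ : ℝ) (v : NNReal) (x : ℝ) :
    gaussianPDFReal (-μ) v (-x) = gaussianPDFReal μ v x := by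
  rw [gaussianPDFReal, gaussianPDFReal, ← neg_sub', neg_sq]

theorem llrPdf_zero (m : ℕ) (σ l : ℝ) : llrPdf m σ 0 l = ∑ j ∈ Finset.range (2 ^ m / 2),
    weight m j * gaussianPDFReal (mean m σ j) (var m σ j).toNNReal l := by
  simp only [llrPdf, ZMod.val_zero, pow_zero, one_mul]

theorem llrPdf_one (m : ℕ) (σ l : ℝ) : llrPdf m σ 1 l = ∑ j ∈ Finset.range (2 ^ m / 2),
    weight m j * gaussianPDFReal (-mean m σ j) (var m σ j).toNNReal l := by
  simp only [llrPdf, ZMod.val_one, pow_one, neg_one_mul]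

theorem llrPdf_one_neg (m : ℕ) (σ l : ℝ) : llrPdf m σ 1 (-l) = llrPdf m σ 0 l := by
  simp_rw [llrPdf_zero, llrPdf_one, gaussianPDFReal_neg_neg]

theorem llrPdf_zero_neg (m : ℕ) (σ l : ℝ) : llrPdf m σ 0 (-l) = llrPdf m σ 1 l := by
  rw [← llrPdf_one_neg, neg_neg]

theorem symLlrPdf_eq_llrPdf (m : ℕ) (σ : ℝ) (b : ZMod 2) (l : ℝ) :
    symLlrPdf m σ b l = llrPdf m σ b l := by
  obtain rfl | rfl := eq_zero_or_eq_one b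
  · rw [symLlrPdf, sub_zero, llrPdf_one_neg, add_self_div_two]
  · rw [symLlrPdf, sub_self, llrPdf_zero_neg, add_self_div_two]

theorem llrPdf_zero_eq_exp_mul (hm : 1 ≤ m) (hσ : σ ≠ 0) (l : ℝ) :
    llrPdf m σ 0 l = Real.exp l * llrPdf m σ 1 l := by
  rw [llrPdf_zero, llrPdf_one, Finset.mul_sum]
  refine Finset.sum_congr rfl fun j _ => ?_
  have hmean := mean_pos hm hσ j
  -- The exponents differ by `2 * l * mean / var`, and the variance is twice the mean.
  have hexponent : -(l - mean m σ j) ^ 2 / (2 * var m σ j) =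
      l + -(l - -mean m σ j) ^ 2 / (2 * var m σ j) := by
    rw [var_eq_two_mul_mean]
    field_simp
    ring
  rw [gaussianPDFReal, gaussianPDFReal, Real.coe_toNNReal _ (var_pos hm hσ j).le, hexponent,
    Real.exp_add]
  ring

theorem llrPdf_zero_pos (hm : 1 ≤ m) (hσ : σ ≠ 0) (l : ℝ) : 0 < llrPdf m σ 0 l := by
  have hM : 2 ≤ 2 ^ m := le_self_pow₀ one_le_two (by omega)
  have hvar : (var m σ 0).toNNReal ≠ 0 := (Real.toNNReal_pos.2 (var_pos hm hσ 0)).ne'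
  rw [llrPdf_zero]
  exact Finset.sum_pos' (fun j _ => mul_nonneg (weight_nonneg m j) (gaussianPDFReal_nonneg _ _ _))
    ⟨0, Finset.mem_range.2 (Nat.div_pos hM two_pos),
      mul_pos (weight_zero_pos hm) (gaussianPDFReal_pos _ _ _ hvar)⟩

theorem llrPdf_one_pos (hm : 1 ≤ m) (hσ : σ ≠ 0) (l : ℝ) : 0 < llrPdf m σ 1 l :=
  llrPdf_zero_neg m σ l ▸ llrPdf_zero_pos hm hσ (-l)

theorem measurable_llrPdf (m : ℕ) (σ : ℝ) (b : ZMod 2) : Measurable (llrPdf m σ b) :=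
  Finset.measurable_fun_sum _ fun _ _ => (measurable_gaussianPDFReal _ _).const_mul _

theorem symLlrLaw_eq_withDensity_llrPdf (m : ℕ) (σ : ℝ) (b : ZMod 2) :
    symLlrLaw m σ b = volume.withDensity fun l => ENNReal.ofReal (llrPdf m σ b l) := by
  simp only [symLlrLaw, symLlrPdf_eq_llrPdf]

theorem symLlrLaw_zero_eq_sum_gaussianReal (hm : 1 ≤ m) (hσ : σ ≠ 0) : symLlrLaw m σ 0 =
    ∑ j ∈ Finset.range (2 ^ m / 2), ENNReal.ofReal (weight m j) •
      gaussianReal (mean m σ j) (var m σ j).toNNReal := by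
  have hdensity (l : ℝ) : ENNReal.ofReal (llrPdf m σ 0 l) = ∑ j ∈ Finset.range (2 ^ m / 2),
      ENNReal.ofReal (weight m j) * gaussianPDF (mean m σ j) (var m σ j).toNNReal l := by
    rw [llrPdf_zero, ENNReal.ofReal_sum_of_nonneg fun j _ =>
      mul_nonneg (weight_nonneg m j) (gaussianPDFReal_nonneg _ _ _)]
    exact Finset.sum_congr rfl fun j _ => ENNReal.ofReal_mul (weight_nonneg m j)
  ext A hA
  rw [symLlrLaw_eq_withDensity_llrPdf, withDensity_apply _ hA, Measure.finsetSum_apply]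
  simp_rw [hdensity]
  rw [lintegral_finsetSum _ fun j _ => (measurable_gaussianPDF _ _).const_mul _]
  refine Finset.sum_congr rfl fun j _ => ?_
  rw [lintegral_const_mul _ (measurable_gaussianPDF _ _), Measure.smul_apply, smul_eq_mul,
    gaussianReal_apply _ (Real.toNNReal_pos.2 (var_pos hm hσ j)).ne']

theorem symLlrLaw_zero_real_apply (hm : 1 ≤ m) (hσ : σ ≠ 0) (A : Set ℝ) :
    (symLlrLaw m σ 0).real A = ∑ j ∈ Finset.range (2 ^ m / 2),
      weight m j * (gaussianReal (mean m σ j) (var m σ j).toNNReal).real A := by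
  simp only [measureReal_def, symLlrLaw_zero_eq_sum_gaussianReal hm hσ, Measure.finsetSum_apply,
    Measure.smul_apply, smul_eq_mul]
  rw [ENNReal.toReal_sum fun j _ => ENNReal.mul_ne_top ENNReal.ofReal_ne_top (measure_ne_top _ _)]
  simp_rw [ENNReal.toReal_mul, ENNReal.toReal_ofReal (weight_nonneg m _)]

theorem isProbabilityMeasure_symLlrLaw (hm : 1 ≤ m) (hσ : σ ≠ 0) :
    IsProbabilityMeasure (symLlrLaw m σ 0) := by
  refine ⟨?_⟩
  rw [symLlrLaw_zero_eq_sum_gaussianReal hm hσ, Measure.finsetSum_apply]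
  simp_rw [Measure.smul_apply, measure_univ, smul_eq_mul, mul_one]
  rw [← ENNReal.ofReal_sum_of_nonneg fun j _ => weight_nonneg m j, sum_weight hm,
    ENNReal.ofReal_one]

theorem symLlrLaw_real_pos (hm : 1 ≤ m) (hσ : σ ≠ 0) {A : Set ℝ} (hA : volume A ≠ 0) :
    0 < (symLlrLaw m σ 0).real A := by
  have := isProbabilityMeasure_symLlrLaw hm hσ
  refine ENNReal.toReal_pos (fun h => hA ?_) (measure_ne_top _ _)
  rw [symLlrLaw_eq_withDensity_llrPdf] at h
  exact withDensity_absolutelyContinuous'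
    (measurable_llrPdf m σ 0).ennreal_ofReal.aemeasurable
    (ae_of_all _ fun l => (ENNReal.ofReal_pos.2 (llrPdf_zero_pos hm hσ l)).ne') h

theorem gaussianReal_real_Ioi (y : ℝ) : (gaussianReal 0 1).real (Set.Ioi y) = Q y := by
  rw [measureReal_def, gaussianReal_apply_eq_integral _ one_ne_zero, ENNReal.toReal_ofReal
    (setIntegral_nonneg measurableSet_Ioi fun _ _ => gaussianPDFReal_nonneg _ _ _), Q,
    ← integral_const_mul]
  refine integral_congr_ae (ae_of_all _ fun ξ => ?_)
  simp [gaussianPDFReal]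

theorem gaussianReal_eq_map_standard (μ : ℝ) {v : ℝ} (hv : 0 ≤ v) :
    gaussianReal μ v.toNNReal = (gaussianReal 0 1).map fun x => μ + -√v * x := by
  have hscale := gaussianReal_map_const_mul (μ := 0) (v := 1) (-√v)
  have hshift := gaussianReal_map_const_add (μ := -√v * 0)
    (v := NNReal.mk ((-√v) ^ 2) (sq_nonneg _) * 1) μ
  have hvar : NNReal.mk ((-√v) ^ 2) (sq_nonneg _) * 1 = v.toNNReal := by
    ext
    simp [Real.sq_sqrt hv, hv]
  rw [← hscale, Measure.map_map (by fun_prop) (by fun_prop), hvar, mul_zero, zero_add] at hshift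
  exact hshift.symm

theorem gaussianReal_real_Iio (μ a : ℝ) {v : ℝ} (hv : 0 < v) :
    (gaussianReal μ v.toNNReal).real (Set.Iio (-a)) = Q ((a + μ) / √v) := by
  rw [gaussianReal_eq_map_standard μ hv.le,
    map_measureReal_apply (by fun_prop) measurableSet_Iio, ← gaussianReal_real_Ioi]
  congr 1
  ext x
  rw [Set.mem_preimage, Set.mem_Iio, Set.mem_Ioi, div_lt_iff₀ (Real.sqrt_pos.2 hv)]
  constructor <;> intro h <;> linarith

theorem symLlrLaw_real_Iio_neg (hm : 1 ≤ m) (hσ : σ ≠ 0) (a : ℝ) :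
    (symLlrLaw m σ 0).real (Set.Iio (-a)) = mixQ m σ a := by
  simp_rw [symLlrLaw_zero_real_apply hm hσ, gaussianReal_real_Iio _ _ (var_pos hm hσ _)]
  rfl

theorem mixQ_zero (m : ℕ) (σ : ℝ) :
    mixQ m σ 0 = ∑ j ∈ Finset.range (2 ^ m / 2), weight m j * Q (mean m σ j / sd m σ j) := by
  simp only [mixQ, zero_add]

theorem symLlrLaw_real_Iio_zero (hm : 1 ≤ m) (hσ : σ ≠ 0) :
    (symLlrLaw m σ 0).real (Set.Iio 0) = mixQ m σ 0 := by
  rw [← symLlrLaw_real_Iio_neg hm hσ, neg_zero]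

theorem mixQDiff_eq_sub (m : ℕ) (σ a : ℝ) : mixQDiff m σ a = mixQ m σ a - mixQ m σ 0 := by
  simp_rw [mixQ_zero, mixQDiff, mixQ, mul_sub, Finset.sum_sub_distrib]

theorem symLlrLaw_real_Ico (hm : 1 ≤ m) (hσ : σ ≠ 0) {a : ℝ} (ha : a ≤ 0) :
    (symLlrLaw m σ 0).real (Set.Ico 0 (-a)) = mixQDiff m σ a := by
  have := isProbabilityMeasure_symLlrLaw hm hσ
  rw [mixQDiff_eq_sub, ← symLlrLaw_real_Iio_neg hm hσ, ← symLlrLaw_real_Iio_zero hm hσ,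
    ← measureReal_sdiff (Set.Iio_subset_Iio (neg_nonneg.2 ha)) measurableSet_Iio]
  congr 1
  ext x
  simp [and_comm]

theorem mixQ_zero_mem_Ioo (hm : 1 ≤ m) (hσ : σ ≠ 0) : mixQ m σ 0 ∈ Set.Ioo (0 : ℝ) 1 := by
  have := isProbabilityMeasure_symLlrLaw hm hσ
  have hcompl := probReal_add_probReal_compl (μ := symLlrLaw m σ 0) (measurableSet_Iio (a := 0))
  have hIio : 0 < (symLlrLaw m σ 0).real (Set.Iio 0) := symLlrLaw_real_pos hm hσ (by simp)
  have hIci : 0 < (symLlrLaw m σ 0).real (Set.Ici 0) := symLlrLaw_real_pos hm hσ (by simp)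
  rw [Set.compl_Iio] at hcompl
  rw [← symLlrLaw_real_Iio_zero hm hσ]
  constructor <;> linarith

end Channel

/-! ### One half-iteration of density evolution -/

theorem hardBit_eq_one_iff (l : ℝ) : hardBit l = 1 ↔ l < 0 := by
  unfold hardBit
  split_ifs with h <;> simp [h]

theorem hardBit_eq_zero_iff (l : ℝ) : hardBit l = 0 ↔ 0 ≤ l := by
  unfold hardBit
  split_ifs with h <;> simpa using h

theorem measurable_comp_hardBit (f : ZMod 2 → ℝ) : Measurable fun l => f (hardBit l) := by
  simp only [hardBit, apply_ite f]
  exact .ite measurableSet_Iio measurable_const measurable_const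

theorem measurableSet_hardBit (b : ZMod 2) : MeasurableSet {l | hardBit l = b} := by
  obtain rfl | rfl := eq_zero_or_eq_one b
  · simp only [hardBit_eq_zero_iff]
    exact measurableSet_Ici
  · simp only [hardBit_eq_one_iff]
    exact measurableSet_Iio

section HalfIteration

variable {n m : ℕ} (C : Submodule (ZMod 2) (Fin n → ZMod 2)) (t : ℕ) {σ : ℝ}

theorem measurable_softValue (m : ℕ) (σ x : ℝ) (s : SignType) :
    Measurable (softValue C t m σ x s) := by
  simp only [funext fun l => softValue.eq_1 C t m σ x s l, symLlrPdf_eq_llrPdf]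
  have hrule (b : ZMod 2) : Measurable fun l => outProb C t x b (hardBit l) s :=
    measurable_comp_hardBit fun r => outProb C t x b r s
  exact (((hrule 0).mul (measurable_llrPdf m σ 0)).div
    ((hrule 1).mul (measurable_llrPdf m σ 1))).log

theorem measurableSet_hardBit_softValue (m : ℕ) (σ x : ℝ) (s : SignType) (b : ZMod 2) :
    MeasurableSet {l | hardBit (softValue C t m σ x s l) = b} :=
  measurable_softValue C t m σ x s (measurableSet_hardBit b)

/-- Probability that the channel hard decision on a zero bit is `r` and that combining its LLR with
the decoder output `s` gives the message `b`. -/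
def decisionMass (m : ℕ) (σ x : ℝ) (b r : ZMod 2) (s : SignType) : ℝ :=
  (symLlrLaw m σ 0).real {l | hardBit l = r ∧ hardBit (softValue C t m σ x s l) = b}

/-- Probability of the outgoing message `b`, when the combining rule is run with the parameter `x`
and the incoming messages have error probability `y`. -/
def messageLaw (m : ℕ) (σ x y : ℝ) (b : ZMod 2) : ℝ :=
  ∑ r, ∑ s, decisionMass C t m σ x b r s * outRate C t y r s

theorem sum_messageLaw [NeZero n] (hm : 1 ≤ m) (hσ : σ ≠ 0) (x y : ℝ) :
    ∑ b, messageLaw C t m σ x y b = 1 := by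
  have := isProbabilityMeasure_symLlrLaw hm hσ
  have hdecision (r : ZMod 2) (s : SignType) :
      ∑ b, decisionMass C t m σ x b r s = (symLlrLaw m σ 0).real {l | hardBit l = r} :=
    sum_measureReal_and _ (measurableSet_hardBit_softValue C t m σ x s)
  calc ∑ b, messageLaw C t m σ x y b
      = ∑ r, ∑ s, (∑ b, decisionMass C t m σ x b r s) * outRate C t y r s := by
        simp_rw [messageLaw, Finset.sum_mul]
        rw [Finset.sum_comm]
        exact Finset.sum_congr rfl fun r _ => Finset.sum_comm
    _ = ∑ r, (symLlrLaw m σ 0).real {l | hardBit l = r} := by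
        simp_rw [hdecision, ← Finset.mul_sum, sum_outRate, mul_one]
    _ = 1 := sum_measureReal_eq_one measurableSet_hardBit

/-- The logarithm of the ratio of the probabilities of the outcome `(r, s)` given a zero and a one;
the combining rule adds it to the channel LLR. -/
def logRatio (x : ℝ) (r : ZMod 2) (s : SignType) : ℝ :=
  Real.log (outRate C t x r s / outRate C t x (r + 1) (-s))

variable {C t} (hC : ∀ j, ∃ c ∈ C, c j = 1) (ht : t ≤ (minDist C - 1) / 2) (hm : 1 ≤ m)
  (hσ : σ ≠ 0) {x : ℝ} (hx : x ∈ Set.Ioo (0 : ℝ) 1)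

include hC ht hm hσ hx

theorem softValue_eq_logRatio_add {r : ZMod 2} {s : SignType} (hr : 0 < outRate C t x r s) {l : ℝ}
    (hl : hardBit l = r) : softValue C t m σ x s l = logRatio C t x r s + l := by
  have hswap := outRate_pos_swap hC ht hx hr
  rw [softValue, hl, outProb_eq_outRate hC ht, outProb_eq_outRate hC ht, if_pos rfl,
    if_neg one_ne_zero, sub_zero, CharTwo.sub_eq_add, symLlrPdf_eq_llrPdf, symLlrPdf_eq_llrPdf,
    llrPdf_zero_eq_exp_mul hm hσ, ← mul_assoc, mul_div_mul_right _ _ (llrPdf_one_pos hm hσ l).ne',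
    mul_div_right_comm, Real.log_mul (div_pos hr hswap).ne' (Real.exp_pos l).ne', Real.log_exp,
    logRatio]

theorem decisionMass_eq {r : ZMod 2} {s : SignType} (hr : 0 < outRate C t x r s) (b : ZMod 2) :
    decisionMass C t m σ x b r s =
      (symLlrLaw m σ 0).real {l | hardBit l = r ∧ hardBit (logRatio C t x r s + l) = b} := by
  rw [decisionMass]
  congr 1
  ext l
  exact and_congr_right fun hl => by rw [softValue_eq_logRatio_add hC ht hm hσ hx hr hl]

theorem decisionMass_one_one {s : SignType} (hr : 0 < outRate C t x 1 s) :
    decisionMass C t m σ x 1 1 s = mixQ m σ (max (logRatio C t x 1 s) 0) := by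
  rw [decisionMass_eq hC ht hm hσ hx hr, ← symLlrLaw_real_Iio_neg hm hσ]
  congr 1
  ext l
  rw [Set.mem_ofPred_eq, Set.mem_Iio, hardBit_eq_one_iff, hardBit_eq_one_iff, lt_neg, max_lt_iff]
  constructor <;> rintro ⟨h, h'⟩ <;> constructor <;> linarith

theorem decisionMass_one_zero {s : SignType} (hr : 0 < outRate C t x 0 s) :
    decisionMass C t m σ x 1 0 s =
      mixQDiff m σ (logRatio C t x 0 s) * Ubar (logRatio C t x 0 s) := by
  have hset : {l | hardBit l = 0 ∧ hardBit (logRatio C t x 0 s + l) = 1} =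
      Set.Ico 0 (-logRatio C t x 0 s) := by
    ext l
    rw [Set.mem_ofPred_eq, Set.mem_Ico, hardBit_eq_zero_iff, hardBit_eq_one_iff,
      lt_neg_iff_add_neg']
  rw [decisionMass_eq hC ht hm hσ hx hr, hset, Ubar]
  split_ifs with hneg
  · rw [symLlrLaw_real_Ico hm hσ hneg.le, mul_one]
  · rw [Set.Ico_eq_empty (by linarith), measureReal_empty, mul_zero]

theorem decisionMass_zero_zero_pos {s : SignType} (hr : 0 < outRate C t x 0 s) :
    0 < decisionMass C t m σ x 0 0 s := by
  have hset : {l | hardBit l = 0 ∧ hardBit (logRatio C t x 0 s + l) = 0} =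
      Set.Ici (max 0 (-logRatio C t x 0 s)) := by
    ext l
    rw [Set.mem_ofPred_eq, Set.mem_Ici, hardBit_eq_zero_iff, hardBit_eq_zero_iff, max_le_iff,
      neg_le_iff_add_nonneg']
  rw [decisionMass_eq hC ht hm hσ hx hr, hset]
  exact symLlrLaw_real_pos hm hσ (by simp)

theorem decisionMass_one_one_pos {s : SignType} (hr : 0 < outRate C t x 1 s) :
    0 < decisionMass C t m σ x 1 1 s := by
  rw [decisionMass_one_one hC ht hm hσ hx hr, ← symLlrLaw_real_Iio_neg hm hσ]
  exact symLlrLaw_real_pos hm hσ (by simp)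

theorem messageLaw_one_eq_g : messageLaw C t m σ x x 1 = g C t m σ x := by
  have hone (s : SignType) : decisionMass C t m σ x 1 1 s * outRate C t x 1 s =
      outRate C t x 1 s * mixQ m σ (max (logRatio C t x 1 s) 0) := by
    obtain h | h := (outRate_nonneg (C := C) (t := t) hx 1 s).eq_or_lt
    · rw [← h, mul_zero, zero_mul]
    · rw [decisionMass_one_one hC ht hm hσ hx h, mul_comm]
  have hzero (s : SignType) : decisionMass C t m σ x 1 0 s * outRate C t x 0 s =
      outRate C t x 0 s * mixQDiff m σ (logRatio C t x 0 s) * Ubar (logRatio C t x 0 s) := by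
    obtain h | h := (outRate_nonneg (C := C) (t := t) hx 0 s).eq_or_lt
    · rw [← h, mul_zero, zero_mul, zero_mul]
    · rw [decisionMass_one_zero hC ht hm hσ hx h, mul_comm, mul_assoc]
  have hsign (F : SignType → ℝ) : ∑ s, F s = F 0 + (F (-1) + (F 1 + 0)) := rfl
  have hbit (F : ZMod 2 → ℝ) : ∑ r, F r = F 0 + F 1 := Fin.sum_univ_two F
  rw [messageLaw, hbit]
  simp only [hzero, hone, hsign]
  simp only [logRatio, g, fPe, fPc, fPeps, fQe, fQc, fQeps, binAvg_one_sub_decProb,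
    binAvg_decProb, neg_neg, neg_zero, zero_add, CharTwo.add_self_eq_zero]
  ring

theorem messageLaw_pos [NeZero n] (b : ZMod 2) : 0 < messageLaw C t m σ x x b := by
  have hterm (r : ZMod 2) (s : SignType) : 0 ≤ decisionMass C t m σ x b r s * outRate C t x r s :=
    mul_nonneg measureReal_nonneg (outRate_nonneg hx r s)
  suffices ∃ r s, 0 < decisionMass C t m σ x b r s ∧ 0 < outRate C t x r s by
    obtain ⟨r, s, hmass, hrate⟩ := this
    exact Finset.sum_pos' (fun r _ => Finset.sum_nonneg fun s _ => hterm r s)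
      ⟨r, Finset.mem_univ r, Finset.sum_pos' (fun s _ => hterm r s)
        ⟨s, Finset.mem_univ s, mul_pos hmass hrate⟩⟩
  have hcorrect : 0 < outRate C t x 0 1 := outRate_zero_one_pos hx
  have hwrong : 0 < outRate C t x 1 (-1) :=
    zero_add (1 : ZMod 2) ▸ outRate_pos_swap hC ht hx hcorrect
  obtain rfl | rfl := eq_zero_or_eq_one b
  · exact ⟨0, 1, decisionMass_zero_zero_pos hC ht hm hσ hx hcorrect, hcorrect⟩
  · exact ⟨1, -1, decisionMass_one_one_pos hC ht hm hσ hx hwrong, hwrong⟩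

theorem g_mem_Ioo [NeZero n] : g C t m σ x ∈ Set.Ioo (0 : ℝ) 1 := by
  have hsum : messageLaw C t m σ x x 0 + messageLaw C t m σ x x 1 = 1 :=
    (Fin.sum_univ_two _).symm.trans (sum_messageLaw C t hm hσ x x)
  have hzero := messageLaw_pos hC ht hm hσ hx 0
  have hone := messageLaw_pos hC ht hm hσ hx 1
  rw [← messageLaw_one_eq_g hC ht hm hσ hx]
  constructor <;> linarith

end HalfIteration

/-! ### The decoder as message passing -/

section Decoder

variable {k m : ℕ} (C : Submodule (ZMod 2) (Fin (k + 1) → ZMod 2)) (t : ℕ) {σ : ℝ}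

theorem prod_erase_insertNth {M α : Type*} [CommMonoid M] (f : α → M) (j : Fin (k + 1)) (r : α)
    (e : Fin k → α) :
    ∏ i ∈ Finset.univ.erase j, f ((j.insertNth r e : Fin (k + 1) → α) i) = ∏ i, f (e i) := by
  rw [← Finset.compl_singleton, ← Fin.image_succAbove_univ,
    Finset.prod_image j.succAbove_right_injective.injOn]
  simp_rw [Fin.insertNth_apply_succAbove]

theorem sum_sum_insertNth {α : Type*} [Fintype α] (j : Fin (k + 1)) (F : (Fin (k + 1) → α) → ℝ) :
    ∑ e : Fin k → α, ∑ r, F (j.insertNth r e) = ∑ w, F w := by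
  rw [Finset.sum_comm, ← Fintype.sum_prod_type']
  exact (Fin.insertNthEquiv (fun _ => α) j).sum_comp F

theorem sum_mul_errorProb (G : ZMod 2 → SignType → ℝ) (y : ℝ) (j : Fin (k + 1)) :
    ∑ w, G (w j) (bddOut C t w j) * errorProb y j w =
      ∑ r, ∑ s, G r s * outRateAt C t y r s j := by
  rw [← Finset.sum_fiberwise _ fun w => (w j, bddOut C t w j), Fintype.sum_prod_type]
  simp_rw [outRateAt, Finset.mul_sum, Prod.mk.injEq]
  refine Finset.sum_congr rfl fun r _ => Finset.sum_congr rfl fun s _ =>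
    Finset.sum_congr rfl fun w hw => ?_
  obtain ⟨-, hr, hs⟩ := Finset.mem_filter.1 hw
  rw [hr, hs]

theorem cnMessage_insertNth (m : ℕ) (σ x : ℝ) (a : ZMod 2) (e : Fin k → ZMod 2) (j : Fin (k + 1))
    (l : ℝ) : cnMessage C t m σ x (j.insertNth a e) j l =
      hardBit (softValue C t m σ x (bddOut C t (j.insertNth (hardBit l) e) j) l) := by
  rw [cnMessage, Fin.update_insertNth]

theorem setOf_hardBit_and_cnMessage (m : ℕ) (σ x : ℝ) (a r b : ZMod 2) (e : Fin k → ZMod 2)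
    (j : Fin (k + 1)) :
    {l | hardBit l = r ∧ cnMessage C t m σ x (j.insertNth a e) j l = b} =
      {l | hardBit l = r ∧ hardBit (softValue C t m σ x (bddOut C t (j.insertNth r e) j) l) = b} :=
  Set.ext fun l => and_congr_right fun hl => by rw [cnMessage_insertNth, hl]

theorem measurableSet_cnMessage (m : ℕ) (σ x : ℝ) (a b : ZMod 2) (e : Fin k → ZMod 2)
    (j : Fin (k + 1)) : MeasurableSet {l | cnMessage C t m σ x (j.insertNth a e) j l = b} := by
  have hcases : {l | cnMessage C t m σ x (j.insertNth a e) j l = b} =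
      ⋃ r, {l | hardBit l = r ∧ cnMessage C t m σ x (j.insertNth a e) j l = b} := by
    ext l
    simp
  rw [hcases]
  refine .iUnion fun r => ?_
  rw [setOf_hardBit_and_cnMessage]
  exact (measurableSet_hardBit r).inter (measurableSet_hardBit_softValue C t m σ x _ b)

/-- The message passing rule of iBDD-CR whose combining rule is run with the parameter `z d` in
step `d`. A constraint node ignores the message that arrives on the edge it answers, so any value,
here `0`, can stand for it. -/
def nodeRule (m : ℕ) (σ : ℝ) (z : ℕ → ℝ) : MessageRule k ℝ (ZMod 2) where
  init := hardBit
  step d j e l := cnMessage C t m σ (z d) (j.insertNth 0 e) j l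
  measurableSet_init := measurableSet_hardBit
  measurableSet_step d j e b := measurableSet_cnMessage C t m σ (z d) 0 b e j

theorem cnMessage_eq_nodeRule_step (m : ℕ) (σ : ℝ) (z : ℕ → ℝ) (d : ℕ) (ψ : Fin (k + 1) → ZMod 2)
    (j : Fin (k + 1)) (l : ℝ) :
    cnMessage C t m σ (z d) ψ j l =
      (nodeRule C t m σ z).step d j (fun i => ψ (j.succAbove i)) l := by
  conv_lhs => rw [← j.insertNth_self_removeNth ψ, cnMessage_insertNth]
  exact (cnMessage_insertNth C t m σ (z d) 0 (j.removeNth ψ) j l).symm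

theorem evolve_nodeRule_zero (hm : 1 ≤ m) (hσ : σ ≠ 0) (z : ℕ → ℝ) :
    (nodeRule C t m σ z).evolve (symLlrLaw m σ 0) 0 1 = mixQ m σ 0 := by
  rw [← symLlrLaw_real_Iio_zero hm hσ]
  exact congrArg _ (Set.ext hardBit_eq_one_iff)

theorem sum_decisionMass_bddOut (hm : 1 ≤ m) (hσ : σ ≠ 0) (x : ℝ) (b : ZMod 2)
    (e : Fin k → ZMod 2) (j : Fin (k + 1)) :
    ∑ r, decisionMass C t m σ x b r (bddOut C t (j.insertNth r e) j) =
      (symLlrLaw m σ 0).real {l | cnMessage C t m σ x (j.insertNth 0 e) j l = b} := by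
  have := isProbabilityMeasure_symLlrLaw hm hσ
  rw [← sum_measureReal_and _ measurableSet_hardBit]
  simp_rw [and_comm (b := hardBit _ = _), setOf_hardBit_and_cnMessage, decisionMass]

theorem evolve_nodeRule_succ (hm : 1 ≤ m) (hσ : σ ≠ 0) (z : ℕ → ℝ) (d : ℕ) (b : ZMod 2) :
    (nodeRule C t m σ z).evolve (symLlrLaw m σ 0) (d + 1) b =
      messageLaw C t m σ (z d) ((nodeRule C t m σ z).evolve (symLlrLaw m σ 0) d 1) b := by
  have := isProbabilityMeasure_symLlrLaw hm hσ
  set q := (nodeRule C t m σ z).evolve (symLlrLaw m σ 0) d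
  have hsum : q 0 + q 1 = 1 :=
    (Fin.sum_univ_two q).symm.trans ((nodeRule C t m σ z).sum_evolve (symLlrLaw m σ 0) d)
  have hbit (a : ZMod 2) : (if a = 1 then q 1 else 1 - q 1) = q a := by
    obtain rfl | rfl := eq_zero_or_eq_one a
    · rw [if_neg zero_ne_one, ← hsum, add_sub_cancel_right]
    · rw [if_pos rfl]
  have hword (j : Fin (k + 1)) (r : ZMod 2) (e : Fin k → ZMod 2) :
      ∏ i, q (e i) = errorProb (q 1) j (j.insertNth r e) := by
    simp_rw [errorProb, hbit]
    exact (prod_erase_insertNth q j r e).symm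
  calc (nodeRule C t m σ z).evolve (symLlrLaw m σ 0) (d + 1) b
      = 𝔼 j, ∑ e : Fin k → ZMod 2,
          (∑ r, decisionMass C t m σ (z d) b r (bddOut C t (j.insertNth r e) j)) *
            ∏ i, q (e i) := by
        simp_rw [sum_decisionMass_bddOut C t hm hσ]
        rfl
    _ = 𝔼 j, ∑ w, decisionMass C t m σ (z d) b (w j) (bddOut C t w j) * errorProb (q 1) j w := by
        refine Finset.expect_congr rfl fun j _ => ?_
        rw [← sum_sum_insertNth j]
        refine Finset.sum_congr rfl fun e _ => ?_
        rw [Finset.sum_mul]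
        exact Finset.sum_congr rfl fun r _ => by rw [hword j r, Fin.insertNth_apply_same]
    _ = messageLaw C t m σ (z d) (q 1) b := by
        simp_rw [sum_mul_errorProb C t (decisionMass C t m σ (z d) b), Finset.expect_sum_comm,
          ← Finset.mul_expect]
        rfl

/-- The error probabilities with which the combining rule is run in the successive half-iterations:
those of the two types of constraint nodes alternate. -/
def stepParam (xr xc : ℕ → ℝ) (d : ℕ) : ℝ := if Even d then xc (d / 2) else xr (d / 2 + 1)

theorem stepParam_two_mul (xr xc : ℕ → ℝ) (ℓ : ℕ) : stepParam xr xc (2 * ℓ) = xc ℓ := by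
  rw [stepParam, if_pos (even_two_mul ℓ), Nat.mul_div_cancel_left ℓ two_pos]

theorem stepParam_two_mul_add_one (xr xc : ℕ → ℝ) (ℓ : ℕ) :
    stepParam xr xc (2 * ℓ + 1) = xr (ℓ + 1) := by
  rw [stepParam, if_neg (Nat.not_even_two_mul_add_one ℓ), Nat.mul_add_div two_pos,
    Nat.div_eq_of_lt one_lt_two, Nat.add_zero]

theorem forall_stepParam_iff {xr xc : ℕ → ℝ} {P : ℕ → ℝ → Prop} :
    (∀ d, P d (stepParam xr xc d)) ↔
      (∀ ℓ, P (2 * ℓ) (xc ℓ)) ∧ ∀ ℓ, P (2 * ℓ + 1) (xr (ℓ + 1)) := by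
  refine ⟨fun h => ⟨fun ℓ => ?_, fun ℓ => ?_⟩, fun h d => ?_⟩
  · exact stepParam_two_mul xr xc ℓ ▸ h (2 * ℓ)
  · exact stepParam_two_mul_add_one xr xc ℓ ▸ h (2 * ℓ + 1)
  · obtain ⟨ℓ, rfl | rfl⟩ := Nat.even_or_odd' d
    · exact (stepParam_two_mul xr xc ℓ).symm ▸ h.1 ℓ
    · exact (stepParam_two_mul_add_one xr xc ℓ).symm ▸ h.2 ℓ

variable {K : ℕ} (xr xc : ℕ → ℝ) (π : Equiv.Perm (Socket K (k + 1))) (l : Socket K (k + 1) → ℝ)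
  (ℓ : ℕ)

theorem rowStep_eq_message (m : ℕ) (σ : ℝ) {ψ : Socket K (k + 1) → ZMod 2}
    (hψ : ∀ v, ψ v = (nodeRule C t m σ (stepParam xr xc)).message (2 * ℓ) π.symm (l ∘ π.symm) (π v))
    (v : Socket K (k + 1)) :
    rowStep C t m σ (xc ℓ) l ψ v =
      (nodeRule C t m σ (stepParam xr xc)).message (2 * ℓ + 1) π l v := by
  rw [rowStep, ← stepParam_two_mul xr xc ℓ, cnMessage_eq_nodeRule_step, MessageRule.message]
  simp_rw [hψ]
  rfl

theorem colMsg_eq_message (m : ℕ) (σ : ℝ) (v : Socket K (k + 1)) :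
    colMsg C t m σ xr xc π l ℓ v =
      (nodeRule C t m σ (stepParam xr xc)).message (2 * ℓ) π.symm (l ∘ π.symm) (π v) := by
  induction ℓ generalizing v with
  | zero => exact congrArg (fun v => hardBit (l v)) (π.symm_apply_apply v).symm
  | succ ℓ ih =>
    rw [colMsg, colStep, ← stepParam_two_mul_add_one xr xc ℓ, cnMessage_eq_nodeRule_step,
      Nat.mul_succ, MessageRule.message]
    simp_rw [rowStep_eq_message C t xr xc π l ℓ m σ ih, Equiv.symm_symm, Function.comp_assoc,
      Equiv.symm_comp_self, Function.comp_apply, Equiv.symm_apply_apply]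
    rfl

theorem rowMsgSucc_eq_message (m : ℕ) (σ : ℝ) (v : Socket K (k + 1)) :
    rowMsgSucc C t m σ xr xc π l ℓ v =
      (nodeRule C t m σ (stepParam xr xc)).message (2 * ℓ + 1) π l v :=
  rowStep_eq_message C t xr xc π l ℓ m σ (fun v => colMsg_eq_message C t xr xc π l ℓ m σ v) v

theorem avgErr_eq_expect (m : ℕ) (σ : ℝ) (n K : ℕ)
    (msg : Equiv.Perm (Socket K n) → (Socket K n → ℝ) → Socket K n → ZMod 2) :
    avgErr m σ n K msg = 𝔼 z : Equiv.Perm (Socket K n) × Socket K n,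
      (Measure.pi fun _ => symLlrLaw m σ 0).real {l | msg z.1 l z.2 = 1} := by
  rw [avgErr, Fintype.expect_eq_sum_div_card, Fintype.sum_prod_type,
    Fintype.card_prod (Equiv.Perm _), Nat.cast_mul]

theorem avgErr_rowMsgSucc (m : ℕ) (σ : ℝ) (K : ℕ) :
    (avgErr m σ (k + 1) K fun π l => rowMsgSucc C t m σ xr xc π l ℓ) =
      (nodeRule C t m σ (stepParam xr xc)).avgLaw (symLlrLaw m σ 0) K (2 * ℓ + 1) 1 := by
  simp_rw [avgErr_eq_expect, rowMsgSucc_eq_message]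
  rfl

theorem avgErr_colMsg (hm : 1 ≤ m) (hσ : σ ≠ 0) (K : ℕ) :
    (avgErr m σ (k + 1) K fun π l => colMsg C t m σ xr xc π l ℓ) =
      (nodeRule C t m σ (stepParam xr xc)).avgLaw (symLlrLaw m σ 0) K (2 * ℓ) 1 := by
  have := isProbabilityMeasure_symLlrLaw hm hσ
  simp_rw [avgErr_eq_expect, colMsg_eq_message]
  let S := Socket K (k + 1)
  have hinv : Function.Bijective fun z : Equiv.Perm S × S => (z.1.symm, z.1 z.2) :=
    Function.Involutive.bijective (f := fun z : Equiv.Perm S × S => (z.1.symm, z.1 z.2))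
      fun z => Prod.ext rfl (z.1.symm_apply_apply z.2)
  refine Fintype.expect_bijective _ hinv _ _ fun z => ?_
  exact (measurePreserving_comp_injective (symLlrLaw m σ 0) z.1.symm.injective).measureReal_preimage
    (MessageRule.measurableSet_message _ _ _ _).nullMeasurableSet

theorem isMessageErrorProb_iff_stepParam_eq_evolve (hm : 1 ≤ m) (hσ : σ ≠ 0) {xr xc : ℕ → ℝ} :
    IsMessageErrorProb C t m σ xr xc ↔ ∀ d, stepParam xr xc d =
      (nodeRule C t m σ (stepParam xr xc)).evolve (symLlrLaw m σ 0) d 1 := by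
  have := isProbabilityMeasure_symLlrLaw hm hσ
  have hlim (d : ℕ) (y : ℝ) : Tendsto (fun K => (nodeRule C t m σ (stepParam xr xc)).avgLaw
      (symLlrLaw m σ 0) K d 1) atTop (𝓝 y) ↔
        y = (nodeRule C t m σ (stepParam xr xc)).evolve (symLlrLaw m σ 0) d 1 :=
    ⟨fun h => tendsto_nhds_unique h (MessageRule.tendsto_avgLaw _ _ d 1),
      fun h => h ▸ MessageRule.tendsto_avgLaw _ _ d 1⟩
  rw [IsMessageErrorProb, forall_stepParam_iff (P := fun d y => y =
    (nodeRule C t m σ (stepParam xr xc)).evolve (symLlrLaw m σ 0) d 1)]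
  simp_rw [avgErr_colMsg C t xr xc _ hm hσ, avgErr_rowMsgSucc, hlim]

end Decoder

/-! ### Density evolution -/

section DensityEvolution

variable {n m : ℕ} {σ : ℝ}

/-- The message error probabilities predicted by density evolution, one half-iteration per step. -/
def densityEvolution (C : Submodule (ZMod 2) (Fin n → ZMod 2)) (t m : ℕ) (σ : ℝ) : ℕ → ℝ
  | 0 => mixQ m σ 0
  | d + 1 => g C t m σ (densityEvolution C t m σ d)

theorem densityEvolution_mem_Ioo [NeZero n] {C : Submodule (ZMod 2) (Fin n → ZMod 2)} {t : ℕ}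
    (hC : ∀ j, ∃ c ∈ C, c j = 1) (ht : t ≤ (minDist C - 1) / 2) (hm : 1 ≤ m) (hσ : σ ≠ 0) (d : ℕ) :
    densityEvolution C t m σ d ∈ Set.Ioo (0 : ℝ) 1 := by
  induction d with
  | zero => exact mixQ_zero_mem_Ioo hm hσ
  | succ d ih => exact g_mem_Ioo hC ht hm hσ ih

variable {k : ℕ} {C : Submodule (ZMod 2) (Fin (k + 1) → ZMod 2)} {t : ℕ}

theorem forall_eq_evolve_nodeRule_iff (hC : ∀ j, ∃ c ∈ C, c j = 1)
    (ht : t ≤ (minDist C - 1) / 2) (hm : 1 ≤ m) (hσ : σ ≠ 0) {z : ℕ → ℝ} :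
    (∀ d, z d = (nodeRule C t m σ z).evolve (symLlrLaw m σ 0) d 1) ↔
      ∀ d, z d = densityEvolution C t m σ d := by
  set y := fun d => (nodeRule C t m σ z).evolve (symLlrLaw m σ 0) d 1
  have hzero : y 0 = densityEvolution C t m σ 0 := evolve_nodeRule_zero C t hm hσ z
  have hsucc (d : ℕ) (hy : y d = densityEvolution C t m σ d)
      (hz : z d = densityEvolution C t m σ d) : y (d + 1) = densityEvolution C t m σ (d + 1) := by
    calc y (d + 1) = messageLaw C t m σ (z d) (y d) 1 := evolve_nodeRule_succ C t hm hσ z d 1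
      _ = densityEvolution C t m σ (d + 1) := by
        rw [hy, hz, messageLaw_one_eq_g hC ht hm hσ (densityEvolution_mem_Ioo hC ht hm hσ d),
          densityEvolution]
  constructor <;> intro h d
  · induction d with
    | zero => exact (h 0).trans hzero
    | succ d ih => exact (h (d + 1)).trans (hsucc d ((h d).symm.trans ih) ih)
  · rw [h]
    induction d with
    | zero => exact hzero.symm
    | succ d ih => exact (hsucc d ih.symm (h d)).symm

theorem isMessageErrorProb_iff (hC : ∀ j, ∃ c ∈ C, c j = 1) (ht : t ≤ (minDist C - 1) / 2)
    (hm : 1 ≤ m) (hσ : σ ≠ 0) {xr xc : ℕ → ℝ} :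
    IsMessageErrorProb C t m σ xr xc ↔
      (∀ ℓ, xc ℓ = densityEvolution C t m σ (2 * ℓ)) ∧
        ∀ ℓ, xr (ℓ + 1) = densityEvolution C t m σ (2 * ℓ + 1) := by
  rw [isMessageErrorProb_iff_stepParam_eq_evolve C t hm hσ,
    forall_eq_evolve_nodeRule_iff hC ht hm hσ,
    forall_stepParam_iff (P := fun d x => x = densityEvolution C t m σ d)]

theorem proposition2_general {n : ℕ} (hn : 0 < n) {C : Submodule (ZMod 2) (Fin n → ZMod 2)}
    (hC : ∀ j : Fin n, ∃ c ∈ C, c j = 1) {t : ℕ} (ht : t ≤ (minDist C - 1) / 2)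
    (hm : 1 ≤ m) (hσ : σ ≠ 0) :
    (∃ xr xc : ℕ → ℝ, IsMessageErrorProb C t m σ xr xc) ∧
    ∀ xr xc : ℕ → ℝ, IsMessageErrorProb C t m σ xr xc →
      xc 0 = ∑ j ∈ Finset.range (2 ^ m / 2), weight m j * Q (mean m σ j / sd m σ j) ∧
      ∀ ℓ : ℕ, 1 ≤ ℓ → xr ℓ = g C t m σ (xc (ℓ - 1)) ∧ xc ℓ = g C t m σ (xr ℓ) := by
  obtain ⟨k, rfl⟩ := Nat.exists_eq_add_one_of_ne_zero hn.ne'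
  simp_rw [isMessageErrorProb_iff hC ht hm hσ]
  refine ⟨⟨fun ℓ => densityEvolution C t m σ (2 * ℓ - 1), fun ℓ => densityEvolution C t m σ (2 * ℓ),
    fun _ => rfl, fun _ => rfl⟩, ?_⟩
  rintro xr xc ⟨hcol, hrow⟩
  refine ⟨(hcol 0).trans (mixQ_zero m σ), fun ℓ hℓ => ?_⟩
  obtain ⟨ℓ, rfl⟩ := Nat.exists_eq_add_of_le' hℓ
  rw [Nat.add_sub_cancel, hrow, hcol, hcol]
  exact ⟨rfl, rfl⟩

end DensityEvolution

end
end IBDDCR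

theorem proposition2 (n : ℕ) (hn : 0 < n) (C : Submodule (ZMod 2) (Fin n → ZMod 2))
    (hC : ∀ j : Fin n, ∃ c ∈ C, c j = 1)
    (t : ℕ) (ht : t = (IBDDCR.minDist C - 1) / 2)
    (m : ℕ) (hm : 1 ≤ m) (σ : ℝ) (hσ : 0 < σ) :
    (∃ xr xc : ℕ → ℝ, IBDDCR.IsMessageErrorProb C t m σ xr xc) ∧
    ∀ xr xc : ℕ → ℝ, IBDDCR.IsMessageErrorProb C t m σ xr xc →
      xc 0 = ∑ j ∈ Finset.range (2 ^ m / 2),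
        IBDDCR.weight m j * IBDDCR.Q (IBDDCR.mean m σ j / IBDDCR.sd m σ j) ∧
      ∀ ℓ : ℕ, 1 ≤ ℓ →
        xr ℓ = IBDDCR.g C t m σ (xc (ℓ - 1)) ∧ xc ℓ = IBDDCR.g C t m σ (xr ℓ) :=
  IBDDCR.proposition2_general hn hC ht.le hm hσ.ne'
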